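/- All graphs are finite and simple. A graph $G$ contains an $H$-subdivision if it has a subgraph obtained from $H$ by replacing edges by internally vertex-disjoint paths. For a family $\mathbb{F}$ of graphs, $G$ is $\mathbb{F}$-subdivision-free if it contains no $F$-subdivision with $F\in\mathbb{F}$, and $\mathbb{F}$-subdivision-saturated if it is $\mathbb{F}$-subdivision-free but adding any edge between two non-adjacent vertices of $G$ creates an $F$-subdivision for some $F\in\mathbb{F}$. Let $\mathrm{SPEX}(n,\mathbb{H}_{\mathrm{sub}})$ be the set of $n$-vertex $\mathbb{H}$-subdivision-free graphs whose adjacency matrix has the maximum spectral radius among all $n$-vertex $\mathbb{H}$-subdivision-free graphs. Put $\gamma_{\mathbb{H}}=\min_{H\in\mathbb{H}}(|H|-\alpha(H)-1)$, where $\alpha(H)$ is the independence number of $H$. For an integer $s$, an induced subgraph $H[S]$ with $|S|=s$ is called irreducible if no induced subgraph $H[T]$ with $|T|=s$ is isomorphic to a proper subgraph of $H[S]$; let $\Gamma^*_s(H)$ be the family of irreducible induced subgraphs of $H$ on $s$ vertices, and let $\Gamma(\mathbb{H})=\bigcup_{H\in\mathbb{H}}\Gamma^*_{|H|-\gamma_{\mathbb{H}}}(H)$.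 **Theorem 5.1.** Let $\mathbb{H}$ be a non-empty finite family of graphs with $\gamma_{\mathbb{H}}\ge 1$. There is an integer $N$, depending only on $\mathbb{H}$, such that for all $n\ge N$ every $G\in\mathrm{SPEX}(n,\mathbb{H}_{\mathrm{sub}})$ has a set $L$ of exactly $\gamma_{\mathbb{H}}$ vertices for which $G-L$ is $\Gamma(\mathbb{H})$-subdivision-saturated. Moreover, $L$ can be chosen so that every vertex of $L$ is adjacent to all other vertices of $G$; and for every graph $G'$ on the vertex set of $G$ in which every vertex of $L$ is adjacent to all other vertices (in particular for $G'=G$), $G'$ is $\mathbb{H}$-subdivision-free if and only if $G'-L$ is $\Gamma(\mathbb{H})$-subdivision-free. -/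

import Mathlib

/-!  Subdivisions of graphs, the parameter `γ`, extremal graphs for the spectral radius, and the
family of irreducible induced subgraphs. All graphs are simple. A family of graphs is indexed:
`H i` is a graph on the vertex type `V i`. -/

namespace SpectralSubdivision

universe u v w

/-- `G` contains a subdivision of `H` as a subgraph: there are distinct branch vertices `φ x`, one
for each vertex `x` of `H`, and for each edge `xy` of `H` a path `P x y` of `G` from `φ x` to `φ y`
(one path per edge: `P y x` is `P x y` reversed), such that no internal vertex of a path is a
branch vertex and paths belonging to different edges have no internal vertex in common. -/
def ContainsSubdivision {V : Type u} {W : Type w} (H : SimpleGraph V) (G : SimpleGraph W) : Prop :=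
  ∃ (φ : V → W) (P : ∀ x y : V, H.Adj x y → G.Walk (φ x) (φ y)),
    Function.Injective φ ∧
    (∀ (x y : V) (h : H.Adj x y), (P x y h).IsPath) ∧
    (∀ (x y : V) (h : H.Adj x y), P y x h.symm = (P x y h).reverse) ∧
    (∀ (x y : V) (h : H.Adj x y) (z : V), φ z ∈ (P x y h).support → z = x ∨ z = y) ∧
    (∀ (x y : V) (h : H.Adj x y) (x' y' : V) (h' : H.Adj x' y'), s(x, y) ≠ s(x', y') →
      ∀ a : W, a ∈ (P x y h).support → a ∈ (P x' y' h').support → a ∈ Set.range φ)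

/-- `G` contains no subdivision of a member of the family `H`. -/
def IsSubdivisionFree {ι : Type u} {V : ι → Type v} {W : Type w}
    (H : ∀ i, SimpleGraph (V i)) (G : SimpleGraph W) : Prop :=
  ∀ i, ¬ ContainsSubdivision (H i) G

/-- `G` is `H`-subdivision-free, but adding any new edge to `G` creates a subdivision of a
member of the family `H`. -/
def IsSubdivisionSaturated {ι : Type u} {V : ι → Type v} {W : Type w}
    (H : ∀ i, SimpleGraph (V i)) (G : SimpleGraph W) : Prop :=
  IsSubdivisionFree H G ∧
    ∀ a b : W, a ≠ b → ¬ G.Adj a b → ∃ i, ContainsSubdivision (H i) (G ⊔ SimpleGraph.edge a b)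

/-- `γ_H = |H| - α(H) - 1`. The subtraction truncates only for graphs without edges
(where `α(H) = |H|`, and the value here is `0` instead of `-1`). -/
noncomputable def gamma {V : Type v} [Fintype V] (H : SimpleGraph V) : ℕ :=
  Fintype.card V - H.indepNum - 1

/-- `γ` of a family: the minimum of `γ` over its members (`0` for the empty family). -/
noncomputable def familyGamma {ι : Type u} {V : ι → Type v} [∀ i, Fintype (V i)]
    (H : ∀ i, SimpleGraph (V i)) : ℕ :=
  ⨅ i, gamma (H i)

open Classical in
/-- The spectral radius of `G`: the largest modulus of an eigenvalue of the adjacency matrix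
(a real symmetric matrix, so that all its eigenvalues are real). -/
noncomputable def graphSpectralRadius {W : Type w} [Fintype W] (G : SimpleGraph W) : ENNReal :=
  spectralRadius ℝ (G.adjMatrix ℝ)

/-- `SPEX(n, H_sub)`: the `n`-vertex `H`-subdivision-free graphs whose spectral radius is maximum
among all `n`-vertex `H`-subdivision-free graphs. -/
def SPEX {ι : Type u} {V : ι → Type v} (n : ℕ) (H : ∀ i, SimpleGraph (V i)) :
    Set (SimpleGraph (Fin n)) :=
  {G | IsSubdivisionFree H G ∧
    ∀ G' : SimpleGraph (Fin n), IsSubdivisionFree H G' →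
      graphSpectralRadius G' ≤ graphSpectralRadius G}

/-- `H[S]` is irreducible: no induced subgraph `H[T]` with `|T| = |S|` is isomorphic to a proper
subgraph of `H[S]`. -/
def IsIrreducibleInduced {V : Type v} (H : SimpleGraph V) (S : Finset V) : Prop :=
  ¬ ∃ T : Finset V, T.card = S.card ∧
    ∃ K : (H.induce (S : Set V)).Subgraph, K ≠ ⊤ ∧ Nonempty (H.induce (T : Set V) ≃g K.coe)

/-- The index type of `Γ(H)`: a member `H i` together with a set `S` of `|H i| - γ` vertices
of it (`γ` being that of the family) such that `H i [S]` is irreducible. -/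
def GammaIndex {ι : Type u} {V : ι → Type v} [∀ i, Fintype (V i)]
    (H : ∀ i, SimpleGraph (V i)) : Type (max u v) :=
  Σ i, {S : Finset (V i) //
    S.card = Fintype.card (V i) - familyGamma H ∧ IsIrreducibleInduced (H i) S}

/-- The family `Γ(H)` of the irreducible induced subgraphs on `|H i| - γ` vertices of the
members `H i`. -/
def GammaFamily {ι : Type u} {V : ι → Type v} [∀ i, Fintype (V i)]
    (H : ∀ i, SimpleGraph (V i)) (j : GammaIndex H) :
    SimpleGraph ((j.2.1 : Finset (V j.1)) : Set (V j.1)) :=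
  (H j.1).induce (j.2.1 : Set (V j.1))

/-- `G - L`: the subgraph of `G` induced by the vertices outside `L`. -/
def deleteVertices {W : Type w} (G : SimpleGraph W) (L : Finset W) :
    SimpleGraph ((L : Set W)ᶜ : Set W) :=
  G.induce (L : Set W)ᶜ

/-- Every vertex of `L` is adjacent to all other vertices of `G`. -/
def IsDominatingIn {W : Type w} (G : SimpleGraph W) (L : Finset W) : Prop :=
  ∀ a ∈ L, ∀ b, b ≠ a → G.Adj a b

end SpectralSubdivision

/-! Write γ for γ_ℍ. A vertex of a subdivision of H is a branch vertex or lies inside a single path,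
so deleting a set L of γ vertices costs at most γ branch vertices. What remains contains a
subdivision of an induced subgraph of H on |H| - γ vertices, and a choice with the fewest edges is
irreducible. Conversely, if L is joined to everything, its vertices can serve as the missing branch
vertices. This is the equivalence for G' (`isSubdivisionFree_iff_gammaFamily`). Saturation follows:
an edge added outside L without creating a Γ(ℍ)-subdivision would keep G ℍ-subdivision-free, yet
increase the quadratic form at the Perron vector, which is positive because L dominates.

The work lies in finding L. A member H₀ attaining γ satisfies |H₀| - α(H₀) = γ + 1. Having no
H₀-subdivision, G is sparse in two ways: every vertex set spans linearly few edges (Mader,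
`exists_degSum_bound`), and no γ + 1 vertices have many common neighbours. The join of K_γ with an
edgeless graph is ℍ-subdivision-free, so ρ² ≥ γ(n - γ). On the other hand, up to a small multiple of
√n, the quadratic form of the unit Perron vector is carried by the edges between the bounded set D
of large entries and vertices with at most γ neighbours in D; Cauchy-Schwarz bounds this part by
√(γn). Near-equality forces exactly γ large entries, at a set L whose vertices are adjacent to
almost everything (`exists_large_entries`).

The exceptions are removed by comparison (`exists_isDominatingIn`). Let B be the vertices outside L
that miss a neighbour in L. Join L to everything and delete the edges of G - L at B and at a bounded
set F of spare common neighbours of L. The new graph is still ℍ-subdivision-free, since a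
subdivision in it could be rebuilt in G with the help of F. Each vertex of B now sees all the weight
of L, and this gain exceeds the loss at F, where the entries are O(1/√n). Maximality of ρ then
leaves no vertex in B and no missing edge in L. -/

namespace SpectralSubdivision

universe u v w

/-! ### Subdivisions described by walks through disjoint sets -/

/-- There is a walk of `G` from `a` to `b` all of whose other vertices lie in `I`. -/
def Linked {W : Type w} (G : SimpleGraph W) (a b : W) (I : Set W) : Prop :=
  ∃ p : G.Walk a b, ∀ c ∈ p.support, c = a ∨ c = b ∨ c ∈ I

namespace Linked

variable {W : Type w} {G : SimpleGraph W} {a b c : W} {I J : Set W}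

theorem of_adj (h : G.Adj a b) : Linked G a b I :=
  ⟨h.toWalk, fun c hc => by simp at hc; tauto⟩

theorem refl : Linked G a a I := ⟨.nil, fun c hc => by simp at hc; tauto⟩

theorem symm (h : Linked G a b I) : Linked G b a I := by
  obtain ⟨p, hp⟩ := h
  refine ⟨p.reverse, fun c hc => ?_⟩
  have := hp c (by simpa using hc)
  tauto

theorem mono (hIJ : I ⊆ J) (h : Linked G a b I) : Linked G a b J := by
  obtain ⟨p, hp⟩ := h
  refine ⟨p, fun c hc => ?_⟩
  have := hp c hc
  have := @hIJ c
  tauto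

theorem trans (h : Linked G a b I) (h' : Linked G b c I) (hb : b ∈ I) : Linked G a c I := by
  obtain ⟨p, hp⟩ := h
  obtain ⟨q, hq⟩ := h'
  refine ⟨p.append q, fun d hd => ?_⟩
  rw [SimpleGraph.Walk.mem_support_append_iff] at hd
  rcases hd with hd | hd
  · rcases hp d hd with rfl | rfl | h <;> tauto
  · rcases hq d hd with rfl | rfl | h <;> tauto

theorem map {W' : Type*} {G' : SimpleGraph W'} (f : G →g G') (h : Linked G a b I) :
    Linked G' (f a) (f b) (f '' I) := by
  obtain ⟨p, hp⟩ := h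
  refine ⟨p.map f, fun c hc => ?_⟩
  rw [SimpleGraph.Walk.support_map, List.mem_map] at hc
  obtain ⟨d, hd, rfl⟩ := hc
  rcases hp d hd with rfl | rfl | h
  · exact Or.inl rfl
  · exact Or.inr (Or.inl rfl)
  · exact Or.inr (Or.inr ⟨d, h, rfl⟩)

theorem induce {s : Set W} (ha : a ∈ s) (hb : b ∈ s) (hI : I ⊆ s) (h : Linked G a b I) :
    Linked (G.induce s) ⟨a, ha⟩ ⟨b, hb⟩ (Subtype.val ⁻¹' I) := by
  obtain ⟨p, hp⟩ := h
  have hs : ∀ c ∈ p.support, c ∈ s := by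
    intro c hc
    rcases hp c hc with rfl | rfl | h
    exacts [ha, hb, hI h]
  refine ⟨p.induce s hs, fun c hc => ?_⟩
  have := hp c.1 (by
    rw [SimpleGraph.Walk.support_induce] at hc
    simpa using hc)
  simpa [Subtype.ext_iff] using this

/-- Nontrivially linked vertices have neighbours. -/
theorem exists_adj (h : Linked G a b I) (hab : a ≠ b) : ∃ c, G.Adj a c := by
  obtain ⟨p, -⟩ := h
  cases p with
  | nil => exact absurd rfl hab
  | cons h p => exact ⟨_, h⟩

end Linked

/-- A subdivision given by the injection `φ` of the branch vertices and sets `I e` that contain the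
internal vertices of the paths. -/
theorem containsSubdivision_iff {V : Type v} {W : Type w} {H : SimpleGraph V} {G : SimpleGraph W} :
    ContainsSubdivision H G ↔ ∃ (φ : V → W) (I : Sym2 V → Set W), Function.Injective φ ∧
      (∀ e x, φ x ∉ I e) ∧ (∀ e e' a, a ∈ I e → a ∈ I e' → e = e') ∧
      ∀ x y, H.Adj x y → Linked G (φ x) (φ y) (I s(x, y)) := by
  classical
  constructor
  · rintro ⟨φ, P, hφ, -, -, hz, hd⟩
    refine ⟨φ, fun e => {a | a ∉ Set.range φ ∧ ∃ x y h, s(x, y) = e ∧ a ∈ (P x y h).support},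
      hφ, fun e x h => h.1 ⟨x, rfl⟩, ?_, ?_⟩
    · rintro e e' a ⟨ha, x, y, h, rfl, hs⟩ ⟨-, x', y', h', rfl, hs'⟩
      by_contra hne
      exact ha (hd x y h x' y' h' hne a hs hs')
    · intro x y h
      refine ⟨P x y h, fun c hc => ?_⟩
      by_cases hr : c ∈ Set.range φ
      · obtain ⟨z, rfl⟩ := hr
        rcases hz x y h z hc with rfl | rfl <;> simp
      · exact Or.inr (Or.inr ⟨hr, x, y, h, rfl, hc⟩)
  · rintro ⟨φ, I, hφ, hr, hd, hl⟩
    choose p hp using hl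
    let q : ∀ x y : V, H.Adj x y → G.Walk (φ x) (φ y) := fun x y h => (p x y h).bypass
    have hq : ∀ x y h, ∀ c ∈ (q x y h).support, c = φ x ∨ c = φ y ∨ c ∈ I s(x, y) :=
      fun x y h c hc => hp x y h c (SimpleGraph.Walk.support_bypass_subset_support _ hc)
    -- Each edge gets one path, chosen from its smaller end in a well-order; this makes the path for
    -- yx the reverse of the path for xy.
    let P : ∀ x y : V, H.Adj x y → G.Walk (φ x) (φ y) := fun x y h =>
      if WellOrderingRel x y then q x y h else (q y x h.symm).reverse
    have hP : ∀ x y h, ∀ c ∈ (P x y h).support, c = φ x ∨ c = φ y ∨ c ∈ I s(x, y) := by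
      intro x y h c hc
      by_cases hxy : WellOrderingRel x y
      · simp only [P, hxy, if_true] at hc
        exact hq x y h c hc
      · simp only [P, hxy, if_false, SimpleGraph.Walk.support_reverse, List.mem_reverse] at hc
        have := hq y x h.symm c hc
        rw [Sym2.eq_swap] at this
        tauto
    refine ⟨φ, P, hφ, ?_, ?_, ?_, ?_⟩
    · intro x y h
      by_cases hxy : WellOrderingRel x y
      · simp only [P, hxy, if_true]
        exact SimpleGraph.Walk.bypass_isPath _
      · simp only [P, hxy, if_false]
        exact (SimpleGraph.Walk.bypass_isPath _).reverse
    · intro x y h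
      by_cases hxy : WellOrderingRel x y
      · have : ¬ WellOrderingRel y x := fun h' => asymm hxy h'
        simp [P, hxy, this]
      · have : WellOrderingRel y x := by
          rcases trichotomous_of WellOrderingRel x y with h1 | h1 | h1
          · exact absurd h1 hxy
          · exact absurd h1 h.ne
          · exact h1
        simp [P, hxy, this]
    · intro x y h z hz
      rcases hP x y h _ hz with h1 | h1 | h1
      · exact Or.inl (hφ h1)
      · exact Or.inr (hφ h1)
      · exact absurd h1 (hr _ _)
    · intro x y h x' y' h' hne a ha ha'
      rcases hP x y h _ ha with rfl | rfl | h1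
      · exact ⟨_, rfl⟩
      · exact ⟨_, rfl⟩
      · rcases hP x' y' h' _ ha' with rfl | rfl | h2
        · exact ⟨_, rfl⟩
        · exact ⟨_, rfl⟩
        · exact absurd (hd _ _ _ h1 h2) hne

namespace ContainsSubdivision

variable {V : Type v} {W : Type w} {H : SimpleGraph V} {G : SimpleGraph W}

/-- Subdivisions are carried along injective homomorphisms. -/
theorem map {W' : Type*} {G' : SimpleGraph W'} (f : G →g G') (hf : Function.Injective f)
    (h : ContainsSubdivision H G) : ContainsSubdivision H G' := by
  rw [containsSubdivision_iff] at h ⊢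
  obtain ⟨φ, I, hφ, hr, hd, hl⟩ := h
  refine ⟨f ∘ φ, fun e => f '' I e, hf.comp hφ, ?_, ?_, fun x y h => (hl x y h).map f⟩
  · rintro e x ⟨a, ha, h⟩
    exact hr e x (hf h ▸ ha)
  · rintro e e' _ ⟨a, ha, rfl⟩ ⟨b, hb, h⟩
    exact hd e e' a ha (hf h ▸ hb)

theorem mono {G' : SimpleGraph W} (hG : G ≤ G') (h : ContainsSubdivision H G) :
    ContainsSubdivision H G' :=
  h.map (SimpleGraph.Hom.ofLE hG) Function.injective_id

/-- A graph containing a subdivision of `H` contains one of every subgraph of `H`. -/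
theorem comap {V' : Type*} {H' : SimpleGraph V'} (f : H' →g H) (hf : Function.Injective f)
    (h : ContainsSubdivision H G) : ContainsSubdivision H' G := by
  rw [containsSubdivision_iff] at h ⊢
  obtain ⟨φ, I, hφ, hr, hd, hl⟩ := h
  refine ⟨φ ∘ f, fun e => I (e.map f), hφ.comp hf, fun e x => hr _ _, ?_, ?_⟩
  · intro e e' a ha ha'
    exact Sym2.map.injective hf (hd _ _ a ha ha')
  · intro x y h
    simpa using hl _ _ (f.map_adj h)

theorem of_induce {s : Set W} (h : ContainsSubdivision H (G.induce s)) :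
    ContainsSubdivision H G :=
  h.map (SimpleGraph.Embedding.induce (G := G) s).toHom Subtype.val_injective

end ContainsSubdivision

/-! ### Deleting and restoring a set of branch vertices -/

/-- If `G` contains a subdivision of `H`, and `L` is a set of at most `k` vertices, then `G - L`
contains a subdivision of an induced subgraph of `H` on any number `≤ |H| - k` of vertices. -/
theorem exists_induce_containsSubdivision {V : Type v} [Fintype V] {W : Type w}
    {H : SimpleGraph V} {G : SimpleGraph W} (h : ContainsSubdivision H G) (L : Finset W) {k : ℕ}
    (hk : k + L.card ≤ Fintype.card V) :
    ∃ S : Finset V, S.card = k ∧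
      ContainsSubdivision (H.induce (S : Set V)) (deleteVertices G L) := by
  classical
  rw [containsSubdivision_iff] at h
  obtain ⟨φ, I, hφ, hr, hd, hl⟩ := h
  -- The set t holds the branch vertex to be given up on account of l: the one located at l, or an
  -- end of the only edge whose path may use l.
  have hx : ∀ l : W, ∃ t : Finset V, t.card ≤ 1 ∧ (∀ x, φ x = l → x ∈ t) ∧
      ∀ x y, l ∈ I s(x, y) → x ∈ t ∨ y ∈ t := by
    intro l
    by_cases h1 : ∃ x, φ x = l
    · obtain ⟨x, rfl⟩ := h1
      refine ⟨{x}, by simp, fun y hy => by simp [hφ hy], fun y z hy => absurd hy (hr _ _)⟩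
    · by_cases h2 : ∃ x y, l ∈ I s(x, y)
      · obtain ⟨x, y, hxy⟩ := h2
        refine ⟨{x}, by simp, fun z hz => absurd ⟨z, hz⟩ h1, fun z t hz => ?_⟩
        have := hd _ _ _ hxy hz
        simp only [Sym2.eq_iff] at this
        rcases this with ⟨rfl, rfl⟩ | ⟨rfl, rfl⟩ <;> simp
      · exact ⟨∅, by simp, fun z hz => absurd ⟨z, hz⟩ h1, fun z t hz => absurd ⟨z, t, hz⟩ h2⟩
  choose t ht1 ht2 ht3 using hx
  have hB : (L.biUnion t).card ≤ L.card := by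
    simpa using Finset.card_biUnion_le_card_mul L t 1 fun l _ => ht1 l
  obtain ⟨S, hS, hSk⟩ := Finset.exists_subset_card_eq (s := (L.biUnion t)ᶜ) (n := k) (by
    rw [Finset.card_compl]; omega)
  have hSt : ∀ x ∈ S, ∀ l ∈ L, x ∉ t l := by
    intro x hx l hl hxt
    exact (Finset.mem_compl.1 (hS hx)) (Finset.mem_biUnion.2 ⟨l, hl, hxt⟩)
  have hφS : ∀ x : (S : Set V), φ x.1 ∈ ((L : Set W)ᶜ : Set W) := fun x hx =>
    hSt x.1 x.2 _ hx (ht2 _ _ rfl)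
  refine ⟨S, hSk, containsSubdivision_iff.2 ⟨fun x => ⟨φ x.1, hφS x⟩,
    fun e => Subtype.val ⁻¹' I (e.map Subtype.val), ?_, fun e x => hr _ _, ?_, ?_⟩⟩
  · intro x y hxy
    exact Subtype.ext (hφ (Subtype.ext_iff.1 hxy))
  · intro e e' a ha ha'
    exact Sym2.map.injective Subtype.val_injective (hd _ _ a.1 ha ha')
  · intro x y hxy
    refine (hl x.1 y.1 hxy).induce (hφS x) (hφS y) ?_
    intro a ha haL
    rcases ht3 a _ _ ha with h | h
    · exact hSt _ x.2 a haL h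
    · exact hSt _ y.2 a haL h

/-- A set of vertices that carries a subdivided induced subgraph of `H` with the fewest edges is
irreducible. -/
theorem exists_irreducible_containsSubdivision {V : Type v} [Fintype V] {W : Type w}
    {H : SimpleGraph V} {G : SimpleGraph W} {S : Finset V}
    (h : ContainsSubdivision (H.induce (S : Set V)) G) :
    ∃ T : Finset V, T.card = S.card ∧ IsIrreducibleInduced H T ∧
      ContainsSubdivision (H.induce (T : Set V)) G := by
  classical
  let P : ℕ → Prop := fun n => ∃ T : Finset V, T.card = S.card ∧
    ContainsSubdivision (H.induce (T : Set V)) G ∧ (H.induce (T : Set V)).edgeSet.ncard = n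
  have hP : ∃ n, P n := ⟨_, S, rfl, h, rfl⟩
  obtain ⟨T, hT, hTG, hn⟩ := Nat.find_spec hP
  refine ⟨T, hT, ?_, hTG⟩
  rintro ⟨T', hT', K, hK, ⟨f⟩⟩
  let g : H.induce (T' : Set V) →g H.induce (T : Set V) := K.hom.comp f.toHom
  have hg : Function.Injective g := K.hom_injective.comp f.injective
  have hcard : (H.induce (T' : Set V)).edgeSet.ncard < Nat.find hP := by
    rw [← hn, ← Set.ncard_image_of_injective _ (Sym2.map.injective hg)]
    refine Set.ncard_lt_ncard ⟨?_, ?_⟩ (Set.toFinite _)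
    · rintro _ ⟨e, he, rfl⟩
      induction e with
      | _ x y => exact g.map_adj he
    · intro hsub
      apply hK
      -- Since T' and T have equal size, K is spanning; being proper, it must lack an edge, against
      -- the minimal number of edges.
      have hverts : K.verts = Set.univ := by
        rw [← Set.toFinset_eq_univ, ← Finset.card_eq_iff_eq_univ, Set.toFinset_card,
          ← Fintype.card_congr f.toEquiv]
        simpa using hT'
      refine SimpleGraph.Subgraph.ext (by simpa using hverts) ?_
      ext a b
      simp only [SimpleGraph.Subgraph.top_adj]
      refine ⟨fun hab => K.adj_sub hab, fun hab => ?_⟩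
      obtain ⟨e, he, hab'⟩ := hsub (show s(a, b) ∈ (H.induce (T : Set V)).edgeSet from hab)
      induction e with
      | _ x y =>
        have h1 : K.Adj (f x) (f y) := f.map_adj_iff.2 he
        rw [Sym2.map_mk, Sym2.eq_iff] at hab'
        rcases hab' with ⟨rfl, rfl⟩ | ⟨rfl, rfl⟩
        · exact h1
        · exact h1.symm
  exact Nat.find_min hP hcard ⟨T', hT'.trans hT, hTG.comap g hg, rfl⟩

/-- If `G - L` contains a subdivision of an induced subgraph of `H` with `|H| - |L|` vertices and the
vertices of `L` are adjacent to all others, then `G` contains a subdivision of `H`. -/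
theorem IsDominatingIn.containsSubdivision {V : Type v} [Fintype V] {W : Type w}
    {H : SimpleGraph V} {G : SimpleGraph W} {L : Finset W} (hL : IsDominatingIn G L) {S : Finset V}
    (hS : S.card + L.card = Fintype.card V)
    (h : ContainsSubdivision (H.induce (S : Set V)) (deleteVertices G L)) :
    ContainsSubdivision H G := by
  classical
  rw [containsSubdivision_iff] at h ⊢
  obtain ⟨φ, I, hφ, hr, hd, hl⟩ := h
  obtain ⟨e⟩ : Nonempty ((Sᶜ : Finset V) ≃ L) := by
    rw [← Fintype.card_eq, Fintype.card_coe, Fintype.card_coe, Finset.card_compl]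
    omega
  let ψ : V → W := fun x => if hx : x ∈ S then (φ ⟨x, hx⟩).1 else (e ⟨x, by simpa using hx⟩).1
  have hψS : ∀ x (hx : x ∈ S), ψ x = (φ ⟨x, hx⟩).1 := fun x hx => by simp [ψ, hx]
  have hψL : ∀ x, x ∉ S → ψ x ∈ L := fun x hx => by simp [ψ, hx]
  have hψ : Function.Injective ψ := by
    intro x y hxy
    by_cases hx : x ∈ S <;> by_cases hy : y ∈ S
    · rw [hψS x hx, hψS y hy] at hxy
      simpa using hφ (Subtype.ext hxy)
    · exact absurd (hψL y hy) (hxy ▸ hψS x hx ▸ (φ ⟨x, hx⟩).2)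
    · exact absurd (hψL x hx) (hxy ▸ hψS y hy ▸ (φ ⟨y, hy⟩).2)
    · simp only [ψ, hx, hy, dif_neg, not_false_eq_true] at hxy
      simpa using e.injective (Subtype.ext hxy)
  refine ⟨ψ, fun e => {a | ∃ e' a', e'.map Subtype.val = e ∧ a' ∈ I e' ∧ a'.1 = a}, hψ, ?_, ?_, ?_⟩
  · rintro e x ⟨e', a', -, ha', hax⟩
    by_cases hx : x ∈ S
    · rw [hψS x hx] at hax
      exact hr e' ⟨x, hx⟩ (Subtype.ext hax ▸ ha')
    · exact a'.2 (hax ▸ hψL x hx)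
  · rintro _ _ _ ⟨e, a, rfl, ha, rfl⟩ ⟨e', a', rfl, ha', haa⟩
    rw [hd e e' a ha (Subtype.ext haa ▸ ha')]
  · intro x y hxy
    by_cases hx : x ∈ S
    · by_cases hy : y ∈ S
      · rw [hψS x hx, hψS y hy]
        refine ((hl ⟨x, hx⟩ ⟨y, hy⟩ hxy).map
          (SimpleGraph.Embedding.induce (G := G) ((L : Set W)ᶜ)).toHom).mono ?_
        rintro _ ⟨a, ha, rfl⟩
        exact ⟨_, a, rfl, ha, rfl⟩
      -- An edge of H with an end outside S needs no internal vertices, as that end is placed in L.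
      · exact .of_adj (hL _ (hψL y hy) _ (hψ.ne hxy.ne)).symm
    · exact .of_adj (hL _ (hψL x hx) _ (hψ.ne hxy.ne.symm))

/-! ### Rebuilding subdivisions with spare common neighbours -/

/-- The edges of `G` inside the set `Q`, as a graph on all vertices. -/
def restrictTo {W : Type w} (G : SimpleGraph W) (Q : Set W) : SimpleGraph W where
  Adj a b := G.Adj a b ∧ a ∈ Q ∧ b ∈ Q
  symm := ⟨fun _ _ h => ⟨h.1.symm, h.2.2, h.2.1⟩⟩
  loopless := ⟨fun _ h => h.1.ne rfl⟩

/-- A walk with at least one edge starts in Q and cannot leave it. The hypothesis a ≠ b excludes the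
trivial walk, which may sit outside Q. -/
theorem Linked.of_restrictTo {W : Type w} {G : SimpleGraph W} {Q I : Set W} {a b : W}
    (hab : a ≠ b) (h : Linked (restrictTo G Q) a b I) : a ∈ Q ∧ b ∈ Q ∧ Linked G a b (I ∩ Q) := by
  obtain ⟨p, hp⟩ := h
  have key : ∀ {a b : W} (p : (restrictTo G Q).Walk a b), a ∈ Q → ∀ c ∈ p.support, c ∈ Q := by
    intro a b p
    induction p with
    | nil => intro h c hc; simpa [List.mem_singleton.1 hc] using h
    | cons had p ih =>
      intro ha c hc
      rw [SimpleGraph.Walk.support_cons, List.mem_cons] at hc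
      rcases hc with rfl | hc
      · exact ha
      · exact ih had.2.2 c hc
  have ha : a ∈ Q := by
    cases p with
    | nil => exact absurd rfl hab
    | cons h p => exact h.2.1
  refine ⟨ha, key p ha b p.end_mem_support,
    p.map (SimpleGraph.Hom.ofLE (fun _ _ h => h.1 : restrictTo G Q ≤ G)), fun c hc => ?_⟩
  rw [SimpleGraph.Walk.support_map] at hc
  have hc' : c ∈ p.support := by simpa using hc
  rcases hp c hc' with h | h | h
  · exact Or.inl h
  · exact Or.inr (Or.inl h)
  · exact Or.inr (Or.inr ⟨h, key p ha c hc'⟩)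

/-- Let every vertex of `Q ∪ M` be adjacent to every vertex of `A`, let `M` be large and disjoint from
`Q`. If the edges inside `Q` contain a subdivision of an induced subgraph of `H` with `|H| - |A|`
vertices, then `G` contains a subdivision of `H`: isolated vertices, and vertices subdividing the
edges inside `A`, are found in `M`. -/
theorem containsSubdivision_of_restrictTo {V : Type v} [Fintype V] {W : Type w}
    {H : SimpleGraph V} {G : SimpleGraph W} {A M : Finset W} {Q : Set W} {S : Finset V}
    (hS : S.card + A.card = Fintype.card V) (hM : ∀ a ∈ A, ∀ r ∈ M, G.Adj a r)
    (hMcard : Fintype.card (V ⊕ Sym2 V) ≤ M.card) (hQ : ∀ a ∈ A, ∀ r ∈ Q, G.Adj a r)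
    (hQM : ∀ r ∈ M, r ∉ Q)
    (h : ContainsSubdivision (H.induce (S : Set V)) (restrictTo G Q)) :
    ContainsSubdivision H G := by
  classical
  rw [containsSubdivision_iff] at h ⊢
  obtain ⟨φ, I, hφ, hr, hd, hl⟩ := h
  obtain ⟨e⟩ : Nonempty ((Sᶜ : Finset V) ≃ A) := by
    rw [← Fintype.card_eq, Fintype.card_coe, Fintype.card_coe, Finset.card_compl]
    omega
  obtain ⟨c⟩ : Nonempty (V ⊕ Sym2 V ↪ M) := by
    apply Function.Embedding.nonempty_of_card_le
    simpa using hMcard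
  have hMA : ∀ r ∈ M, r ∉ A := fun r hr hrA => (hM r hrA r hr).ne rfl
  have hQA : ∀ r ∈ Q, r ∉ A := fun r hr hrA => (hQ r hrA r hr).ne rfl
  have hcM : ∀ t, (c t).1 ∈ M := fun t => (c t).2
  have hcc : ∀ {t t'}, (c t).1 = (c t').1 → t = t' := fun h => c.injective (Subtype.ext h)
  -- A branch vertex outside Q is isolated in the restricted graph, hence stands for an isolated
  -- vertex of H[S]. Its old place may lack edges to A, so it is moved to its own vertex of M.
  let ψ : V → W := fun x =>
    if hx : x ∈ S then (if φ ⟨x, hx⟩ ∈ Q then φ ⟨x, hx⟩ else (c (Sum.inl x)).1)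
    else (e ⟨x, by simpa using hx⟩).1
  have hψA : ∀ x, x ∉ S → ψ x ∈ A := fun x hx => by simp [ψ, hx]
  have hψQ : ∀ x (hx : x ∈ S), φ ⟨x, hx⟩ ∈ Q → ψ x = φ ⟨x, hx⟩ :=
    fun x hx h => by simp [ψ, hx, h]
  have hψM : ∀ x (hx : x ∈ S), φ ⟨x, hx⟩ ∉ Q → ψ x = (c (Sum.inl x)).1 :=
    fun x hx h => by simp [ψ, hx, h]
  have hψc : ∀ x e', ψ x ≠ (c (Sum.inr e')).1 := by
    intro x e' h
    by_cases hx : x ∈ S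
    · by_cases hq : φ ⟨x, hx⟩ ∈ Q
      · exact hQM _ (hcM (Sum.inr e')) (h ▸ hψQ x hx hq ▸ hq)
      · rw [hψM x hx hq] at h
        simpa using hcc h
    · exact hMA _ (hcM (Sum.inr e')) (h ▸ hψA x hx)
  have hψSA : ∀ x ∈ S, ∀ a ∈ A, G.Adj a (ψ x) := by
    intro x hx a ha
    by_cases hq : φ ⟨x, hx⟩ ∈ Q
    · rw [hψQ x hx hq]; exact hQ a ha _ hq
    · rw [hψM x hx hq]; exact hM a ha _ (hcM _)
  have hψ : Function.Injective ψ := by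
    intro x y hxy
    by_cases hx : x ∈ S <;> by_cases hy : y ∈ S
    · by_cases hqx : φ ⟨x, hx⟩ ∈ Q <;> by_cases hqy : φ ⟨y, hy⟩ ∈ Q
      · rw [hψQ x hx hqx, hψQ y hy hqy] at hxy
        simpa using hφ hxy
      · rw [hψQ x hx hqx, hψM y hy hqy] at hxy
        exact absurd (hxy ▸ hqx) (hQM _ (hcM _))
      · rw [hψM x hx hqx, hψQ y hy hqy] at hxy
        exact absurd (hxy ▸ hqy) (hQM _ (hcM _))
      · rw [hψM x hx hqx, hψM y hy hqy] at hxy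
        simpa using hcc hxy
    · exact absurd hxy (hψSA x hx _ (hψA y hy)).ne.symm
    · exact absurd hxy (hψSA y hy _ (hψA x hx)).ne
    · simp only [ψ, hx, hy, dif_neg, not_false_eq_true] at hxy
      simpa using e.injective (Subtype.ext hxy)
  -- Each edge also owns a private vertex of M, used when both of its ends lie in A, where adjacency
  -- is not assumed.
  refine ⟨ψ, fun e => {a | a = (c (Sum.inr e)).1 ∨
    ∃ e', e'.map Subtype.val = e ∧ a ∈ I e' ∧ a ∈ Q}, hψ, ?_, ?_, ?_⟩
  · rintro e x (h | ⟨e', -, ha', haQ⟩)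
    · exact hψc x e h
    · by_cases hx : x ∈ S
      · by_cases hq : φ ⟨x, hx⟩ ∈ Q
        · rw [hψQ x hx hq] at ha'
          exact hr e' _ ha'
        · rw [hψM x hx hq] at haQ
          exact hQM _ (hcM _) haQ
      · exact hQA _ haQ (hψA x hx)
  · rintro e₁ e₂ a (rfl | ⟨e₁, rfl, ha, haQ⟩) (h | ⟨e₂, rfl, ha', haQ'⟩)
    · simpa using hcc h
    · exact absurd haQ' (hQM _ (hcM _))
    · exact absurd (h ▸ haQ) (hQM _ (hcM _))
    · rw [hd e₁ e₂ a ha ha']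
  · intro x y hxy
    by_cases hx : x ∈ S
    · by_cases hy : y ∈ S
      · have hne : φ ⟨x, hx⟩ ≠ φ ⟨y, hy⟩ := fun h => hxy.ne (by simpa using hφ h)
        obtain ⟨h1, h2, h3⟩ := (hl ⟨x, hx⟩ ⟨y, hy⟩ hxy).of_restrictTo hne
        rw [hψQ x hx h1, hψQ y hy h2]
        exact h3.mono fun a ha => Or.inr ⟨_, rfl, ha⟩
      · exact .of_adj (hψSA x hx _ (hψA y hy)).symm
    · by_cases hy : y ∈ S
      · exact .of_adj (hψSA y hy _ (hψA x hx))
      · exact .trans (.of_adj (hM _ (hψA x hx) _ (hcM (Sum.inr s(x, y)))))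
          (.of_adj (hM _ (hψA y hy) _ (hcM (Sum.inr s(x, y)))).symm) (Or.inl rfl)

/-- A graph with `|H| - α(H)` vertices that have many common neighbours contains a subdivision
of `H`. -/
theorem containsSubdivision_of_common_neighbors {V : Type v} [Fintype V] {W : Type w}
    {H : SimpleGraph V} {G : SimpleGraph W} {A M : Finset W}
    (hA : A.card + H.indepNum = Fintype.card V) (hM : ∀ a ∈ A, ∀ r ∈ M, G.Adj a r)
    (hMcard : Fintype.card (V ⊕ Sym2 V) ≤ M.card) : ContainsSubdivision H G := by
  classical
  obtain ⟨S, hS⟩ := H.exists_isNIndepSet_indepNum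
  refine containsSubdivision_of_restrictTo (S := S) (Q := ∅) (by rw [hS.card_eq]; omega) hM hMcard
    (by simp) (by simp) ?_
  obtain ⟨c⟩ : Nonempty (V ⊕ Sym2 V ↪ M) := by
    apply Function.Embedding.nonempty_of_card_le
    simpa using hMcard
  refine containsSubdivision_iff.2 ⟨fun x => (c (Sum.inl x.1)).1, fun _ => ∅, ?_, by simp,
    by simp, ?_⟩
  · intro x y h
    have := c.injective (Subtype.ext h)
    exact Subtype.ext (by simpa using this)
  · intro x y hxy
    exact absurd hxy (hS.isIndepSet x.2 y.2 (fun h => hxy.ne (Subtype.ext h)))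

/-! ### Edge density and Mader's theorem -/

open Classical in
/-- The number of neighbours of `a` in `Z`. -/
noncomputable def degIn {W : Type w} (G : SimpleGraph W) (Z : Finset W) (a : W) : ℕ :=
  (Z.filter (G.Adj a)).card

/-- The sum of the degrees of the subgraph induced by `Z`. -/
noncomputable def degSum {W : Type w} (G : SimpleGraph W) (Z : Finset W) : ℕ :=
  ∑ a ∈ Z, degIn G Z a

section

variable {W : Type w} {G : SimpleGraph W}

open Classical in
theorem degIn_le (Z : Finset W) (a : W) : degIn G Z a ≤ Z.card := Finset.card_filter_le _ _

-- An edge at `a` is counted once from each end, whence the factor 2.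
open Classical in
theorem degSum_erase (Z : Finset W) {a : W} (ha : a ∈ Z) :
    degSum G (Z.erase a) + 2 * degIn G Z a = degSum G Z := by
  have h1 : ∀ b, degIn G Z b = degIn G (Z.erase a) b + if G.Adj b a then 1 else 0 := by
    intro b
    unfold degIn
    rw [Finset.filter_erase]
    split_ifs with h
    · rw [Finset.card_erase_add_one (by simp [ha, h])]
    · rw [Finset.erase_eq_of_notMem (by simp [h])]; rfl
  have h2 : degIn G Z a = ∑ b ∈ Z.erase a, if G.Adj b a then 1 else 0 := by
    rw [Finset.sum_boole, degIn, Finset.filter_erase, Finset.erase_eq_of_notMem (by simp)]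
    simp [SimpleGraph.adj_comm]
  have h3 : degSum G Z = degIn G Z a + ∑ b ∈ Z.erase a, degIn G Z b :=
    (Finset.add_sum_erase _ _ ha).symm
  rw [h3, Finset.sum_congr rfl (fun b _ => h1 b), Finset.sum_add_distrib, ← h2, degSum]
  ring

end

/-- A graph without edges is subdivided in every graph with sufficiently many vertices. -/
theorem containsSubdivision_of_card_le {V : Type v} [Fintype V] {W : Type w} {H : SimpleGraph V}
    {G : SimpleGraph W} {Z : Finset W} (hH : H = ⊥) (hZ : Fintype.card V ≤ Z.card) :
    ContainsSubdivision H (G.induce (Z : Set W)) := by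
  obtain ⟨c⟩ : Nonempty (V ↪ (Z : Set W)) := by
    apply Function.Embedding.nonempty_of_card_le
    simpa using hZ
  exact containsSubdivision_iff.2 ⟨c, fun _ => ∅, c.injective, by simp, by simp, by simp [hH]⟩

open Classical in
/-- The neighbours of `U` in `Z`. -/
noncomputable def outerBoundary {W : Type w} (G : SimpleGraph W) (Z U : Finset W) : Finset W :=
  (Z \ U).filter fun a => ∃ u ∈ U, G.Adj u a

/-- If `U` is connected and disjoint from `N`, all vertices of `N` have neighbours in `U`, and `N`
contains a subdivision of `H - xy`, then there is a subdivision of `H` in `G`. -/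
theorem containsSubdivision_of_deleteEdge {V : Type v} {W : Type w} {H : SimpleGraph V}
    {G : SimpleGraph W} {U N : Finset W} (hU : ∀ a ∈ U, ∀ b ∈ U, Linked G a b U)
    (hUN : ∀ a ∈ N, a ∉ U ∧ ∃ u ∈ U, G.Adj u a) {x y : V}
    (h : ContainsSubdivision (H.deleteEdges {s(x, y)}) (G.induce (N : Set W))) :
    ContainsSubdivision H (G.induce ((U : Set W) ∪ N)) := by
  classical
  rw [containsSubdivision_iff] at h ⊢
  obtain ⟨φ, I, hφ, hr, hd, hl⟩ := h
  have hsub : ∀ e, (Subtype.val '' I e) ⊆ (N : Set W) := by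
    rintro e _ ⟨a, -, rfl⟩; exact a.2
  have hφN : ∀ x, (φ x).1 ∈ N := fun x => (φ x).2
  have hφm : ∀ x, (φ x).1 ∈ (U : Set W) ∪ N := fun x => Or.inr (hφN x)
  let J : Sym2 V → Set W := fun e => if e = s(x, y) then (U : Set W) else Subtype.val '' I e
  have hJ : ∀ e, J e ⊆ (U : Set W) ∪ N := by
    intro e
    by_cases he : e = s(x, y)
    · simp [J, he]
    · simp only [J, he, if_false]
      exact (hsub e).trans Set.subset_union_right
  refine ⟨fun z => ⟨(φ z).1, hφm z⟩, fun e => Subtype.val ⁻¹' J e, ?_, ?_, ?_, ?_⟩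
  · intro a b hab
    exact hφ (Subtype.ext (congrArg (fun t => t.1) hab))
  · intro e z hz
    by_cases he : e = s(x, y)
    · simp only [J, he, if_true, Set.mem_preimage] at hz
      exact (hUN _ (hφN z)).1 hz
    · simp only [J, he, if_false, Set.mem_preimage] at hz
      obtain ⟨a, ha, haz⟩ := hz
      exact hr e z (Subtype.ext haz ▸ ha)
  · intro e e' a ha ha'
    by_cases he : e = s(x, y) <;> by_cases he' : e' = s(x, y)
    · rw [he, he']
    · simp only [J, he, he', if_true, if_false, Set.mem_preimage] at ha ha'
      exact absurd ha (hUN _ (hsub _ ha')).1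
    · simp only [J, he, he', if_true, if_false, Set.mem_preimage] at ha ha'
      exact absurd ha' (hUN _ (hsub _ ha)).1
    · simp only [J, he, he', if_false, Set.mem_preimage] at ha ha'
      obtain ⟨b, hb, hba⟩ := ha
      obtain ⟨b', hb', hba'⟩ := ha'
      exact hd e e' b hb (Subtype.ext (hba.trans hba'.symm) ▸ hb')
  · intro a b hab
    refine Linked.induce (hφm a) (hφm b) (hJ _) ?_
    by_cases he : s(a, b) = s(x, y)
    · simp only [J, he, if_true]
      obtain ⟨-, u, hu, hua⟩ := hUN _ (hφN a)
      obtain ⟨-, t, ht, htb⟩ := hUN _ (hφN b)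
      exact (Linked.of_adj hua.symm).trans ((hU u hu t ht).trans (.of_adj htb) ht) hu
    · simp only [J, he, if_false]
      exact (hl a b (by simpa [hab] using he)).map
        (SimpleGraph.Embedding.induce (G := G) (N : Set W)).toHom

/-- **Mader's theorem**: linearly many edges force a subdivision of `H`. -/
theorem exists_degSum_bound {V : Type v} [Fintype V] (H : SimpleGraph V) :
    ∃ c : ℕ, ∀ {W : Type w} (G : SimpleGraph W) (Z : Finset W), Z.Nonempty →
      c * Z.card ≤ degSum G Z → ContainsSubdivision H (G.induce (Z : Set W)) := by
  classical
  induction hm : H.edgeSet.ncard using Nat.strong_induction_on generalizing H with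
  | _ m ihm =>
  by_cases hH : H = ⊥
  · refine ⟨Fintype.card V, fun G Z hZ h => containsSubdivision_of_card_le hH ?_⟩
    have h1 : degSum G Z ≤ Z.card * Z.card := by
      simpa [degSum] using Finset.sum_le_card_nsmul Z _ Z.card fun a _ => degIn_le (G := G) Z a
    exact Nat.le_of_mul_le_mul_right (h.trans h1) hZ.card_pos
  · obtain ⟨x, y, hxy⟩ := SimpleGraph.ne_bot_iff_exists_adj.1 hH
    obtain ⟨c, hc⟩ := ihm _ (by
      rw [← hm]
      refine Set.ncard_lt_ncard ⟨?_, ?_⟩ (Set.toFinite _)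
      · exact SimpleGraph.edgeSet_mono (SimpleGraph.deleteEdges_le _)
      · intro h
        have : s(x, y) ∈ (H.deleteEdges {s(x, y)}).edgeSet := h hxy
        simp at this) (H.deleteEdges {s(x, y)}) rfl
    refine ⟨2 * c + 2, fun {W} G Z => ?_⟩
    induction hk : Z.card using Nat.strong_induction_on generalizing Z with
    | _ k ihk =>
    intro hZ hdeg
    subst hk
    -- P U says that contracting the connected set U keeps the density: |Z \ U| + 1 vertices remain,
    -- and the contracted vertex has one edge to each vertex of the outer boundary.
    let P : Finset W → Prop := fun U => U.Nonempty ∧ (∀ a ∈ U, ∀ b ∈ U, Linked G a b U) ∧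
      (2 * c + 2) * ((Z \ U).card + 1) ≤ degSum G (Z \ U) + 2 * (outerBoundary G Z U).card
    obtain ⟨z, hz⟩ := hZ
    have hP0 : P {z} := by
      refine ⟨by simp, fun a ha b hb => ?_, ?_⟩
      · rw [Finset.mem_singleton.1 ha, Finset.mem_singleton.1 hb]; exact .refl
      · have h1 : outerBoundary G Z {z} = Z.filter (G.Adj z) := by
          ext a
          simp only [outerBoundary, Finset.mem_filter, Finset.mem_sdiff, Finset.mem_singleton,
            exists_eq_left]
          refine ⟨fun h => ⟨h.1.1, h.2⟩, fun h => ⟨⟨h.1, h.2.ne.symm⟩, h.2⟩⟩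
        have h2 := degSum_erase (G := G) Z hz
        have h3 := Finset.card_erase_add_one hz
        rw [h1, Finset.sdiff_singleton_eq_erase, h3]
        exact hdeg.trans h2.ge
    obtain ⟨U, hU, hmax⟩ := Finset.exists_max_image
      (Z.powerset.filter P) Finset.card ⟨{z}, by simp [hP0, hz]⟩
    rw [Finset.mem_filter, Finset.mem_powerset] at hU
    obtain ⟨hUZ, hne, hconn, hcount⟩ := hU
    set N := outerBoundary G Z U with hN
    have hNmem : ∀ a, a ∈ N ↔ (a ∈ Z ∧ a ∉ U) ∧ ∃ u ∈ U, G.Adj u a := by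
      intro a; simp [hN, outerBoundary]
    have hUN : (U : Set W) ∪ N ⊆ Z := by
      rintro a (ha | ha)
      · exact hUZ ha
      · exact ((hNmem a).1 ha).1.1
    have lift : ∀ {s : Set W}, s ⊆ Z → ContainsSubdivision H (G.induce s) →
        ContainsSubdivision H (G.induce (Z : Set W)) := fun {s} hs h =>
      h.map (SimpleGraph.induceHomOfLE G hs).toHom (SimpleGraph.induceHomOfLE G hs).injective
    -- With no boundary, Z \ U alone inherits the density bound and is smaller than Z. Otherwise the
    -- boundary N carries a subdivision of H - xy, and U supplies the missing path.
    rcases N.eq_empty_or_nonempty with hN0 | hN0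
    · rw [hN0, Finset.card_empty, mul_zero, add_zero] at hcount
      have hlt : (Z \ U).card < Z.card := Finset.card_lt_card
        (Finset.sdiff_ssubset hUZ hne)
      refine lift (by simp) (ihk _ hlt (Z \ U) rfl ?_ (by nlinarith))
      by_contra h
      rw [Finset.not_nonempty_iff_eq_empty.1 h] at hcount
      simp [degSum] at hcount
    -- Merging `a` into U lowers the degree sum of the contracted graph by 2(d + 1), where d is the
    -- degree of `a` inside N. If d < c, this is less than the 2c + 2 by which the required bound
    -- drops, against the maximality of U.
    · have hmin : ∀ a ∈ N, c ≤ degIn G N a := by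
        intro a ha
        by_contra hlt
        obtain ⟨⟨haZ, haU⟩, u, hu, hua⟩ := (hNmem a).1 ha
        have haZU : a ∈ Z \ U := by simp [haZ, haU]
        have hsd : Z \ insert a U = (Z \ U).erase a := by
          ext b; simp only [Finset.mem_sdiff, Finset.mem_insert, Finset.mem_erase]; tauto
        have hPa : P (insert a U) := by
          refine ⟨by simp, ?_, ?_⟩
          · have hm : ∀ {b d}, Linked G b d U → Linked G b d (insert a U : Finset W) :=
              fun h => h.mono (by simp)
            have hua' : ∀ b ∈ U, Linked G b a (insert a U : Finset W) := fun b hb =>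
              (hm (hconn b hb u hu)).trans (.of_adj hua) (by simp [hu])
            intro b hb d hd
            rcases Finset.mem_insert.1 hb with hb' | hb' <;>
              rcases Finset.mem_insert.1 hd with hd' | hd'
            · rw [hb', hd']; exact .refl
            · rw [hb']; exact (hua' d hd').symm
            · rw [hd']; exact hua' b hb'
            · exact hm (hconn b hb' d hd')
          · have h1 := degSum_erase (G := G) (Z \ U) haZU
            have h2 := Finset.card_erase_add_one haZU
            have h3 : N.card + degIn G (Z \ U) a ≤
                (outerBoundary G Z (insert a U)).card + 1 + degIn G N a := by
              have e1 : N.erase a ∪ (Z \ U).filter (G.Adj a) ⊆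
                  outerBoundary G Z (insert a U) := by
                intro b hb
                simp only [outerBoundary, Finset.mem_filter, Finset.mem_sdiff, Finset.mem_insert,
                  Finset.mem_union, Finset.mem_erase] at hb ⊢
                rcases hb with ⟨hba, hb⟩ | ⟨hb, hab⟩
                · obtain ⟨⟨h1, h2⟩, t, ht, htb⟩ := (hNmem b).1 hb
                  exact ⟨⟨h1, by tauto⟩, t, Or.inr ht, htb⟩
                · refine ⟨⟨hb.1, ?_⟩, a, Or.inl rfl, hab⟩
                  rintro (rfl | h)
                  exacts [hab.ne rfl, hb.2 h]
              have e2 : N.erase a ∩ (Z \ U).filter (G.Adj a) ⊆ N.filter (G.Adj a) := by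
                intro b hb
                simp only [Finset.mem_filter, Finset.mem_inter, Finset.mem_erase] at hb ⊢
                exact ⟨hb.1.2, hb.2.2⟩
              have e3 := Finset.card_union_add_card_inter (N.erase a) ((Z \ U).filter (G.Adj a))
              have e4 := Finset.card_le_card e1
              have e5 := Finset.card_le_card e2
              have e6 := Finset.card_erase_add_one ha
              unfold degIn
              omega
            rw [hsd]
            have h4 : (2 * c + 2) * ((Z \ U).card + 1) =
                (2 * c + 2) * (((Z \ U).erase a).card + 1) + (2 * c + 2) := by rw [← h2]; ring
            omega
        have := hmax (insert a U) (by
          simp only [Finset.mem_filter, Finset.mem_powerset]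
          exact ⟨Finset.insert_subset haZ hUZ, hPa⟩)
        rw [Finset.card_insert_of_notMem haU] at this
        omega
      have hdN : c * N.card ≤ degSum G N := by
        rw [mul_comm]
        simpa [degSum] using Finset.card_nsmul_le_sum N _ c hmin
      exact lift hUN (containsSubdivision_of_deleteEdge hconn
        (fun a ha => ⟨((hNmem a).1 ha).1.2, ((hNmem a).1 ha).2⟩) (hc G N hN0 hdN))

/-! ### Rayleigh quotients and Perron vectors -/

section

variable {W : Type w} [Fintype W]

open Classical in
/-- The adjacency matrix of `G` applied to `x`. -/
noncomputable def adjApply (G : SimpleGraph W) (x : W → ℝ) (a : W) : ℝ :=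
  ∑ b, if G.Adj a b then x b else 0

/-- The quadratic form of the adjacency matrix of `G`. -/
noncomputable def adjForm (G : SimpleGraph W) (x : W → ℝ) : ℝ :=
  ∑ a, x a * adjApply G x a

open Classical in
theorem adjApply_eq_mulVec (G : SimpleGraph W) (x : W → ℝ) :
    adjApply G x = (G.adjMatrix ℝ).mulVec x := by
  ext a
  simp [adjApply, Matrix.mulVec, dotProduct, SimpleGraph.adjMatrix_apply]

theorem adjApply_add (G : SimpleGraph W) (x y : W → ℝ) :
    adjApply G (x + y) = adjApply G x + adjApply G y := by
  classical
  simp [adjApply_eq_mulVec, Matrix.mulVec_add]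

theorem adjApply_smul (G : SimpleGraph W) (c : ℝ) (x : W → ℝ) :
    adjApply G (c • x) = c • adjApply G x := by
  classical
  simp [adjApply_eq_mulVec, Matrix.mulVec_smul]

theorem sum_mul_adjApply_comm (G : SimpleGraph W) (x y : W → ℝ) :
    ∑ a, x a * adjApply G y a = ∑ a, y a * adjApply G x a := by
  classical
  simp only [adjApply, Finset.mul_sum]
  rw [Finset.sum_comm]
  refine Finset.sum_congr rfl fun a _ => Finset.sum_congr rfl fun b _ => ?_
  simp only [G.adj_comm a b, mul_ite, mul_zero, mul_comm]

theorem adjForm_add (G : SimpleGraph W) (x y : W → ℝ) :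
    adjForm G (x + y) = adjForm G x + 2 * ∑ a, y a * adjApply G x a + adjForm G y := by
  have := sum_mul_adjApply_comm G x y
  simp only [adjForm, adjApply_add, Pi.add_apply, add_mul, mul_add, Finset.sum_add_distrib]
  linarith

theorem adjForm_smul (G : SimpleGraph W) (c : ℝ) (x : W → ℝ) :
    adjForm G (c • x) = c ^ 2 * adjForm G x := by
  simp only [adjForm, adjApply_smul, Pi.smul_apply, smul_eq_mul, Finset.mul_sum]
  exact Finset.sum_congr rfl fun a _ => by ring

/-- The adjacency matrix has nonnegative entries. This makes a maximizer nonnegative and bounds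
negative eigenvalues as well. -/
theorem abs_adjForm_le (G : SimpleGraph W) (x : W → ℝ) : |adjForm G x| ≤ adjForm G |x| := by
  classical
  refine (Finset.abs_sum_le_sum_abs _ _).trans (Finset.sum_le_sum fun a _ => ?_)
  rw [abs_mul]
  refine mul_le_mul_of_nonneg_left ?_ (abs_nonneg _)
  refine (Finset.abs_sum_le_sum_abs _ _).trans (Finset.sum_le_sum fun b _ => ?_)
  split_ifs <;> simp

theorem continuous_adjForm (G : SimpleGraph W) : Continuous (adjForm G) := by
  classical
  unfold adjForm
  simp only [adjApply_eq_mulVec]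
  fun_prop

/-- The spectral radius is attained by a nonnegative unit eigenvector, and is the maximum of the
Rayleigh quotient. -/
theorem exists_perron (G : SimpleGraph W) [Nonempty W] : ∃ (x : W → ℝ) (ρ : ℝ), 0 ≤ ρ ∧
    (∀ a, 0 ≤ x a) ∧ ∑ a, x a ^ 2 = 1 ∧ (∀ a, adjApply G x a = ρ * x a) ∧
    (∀ y : W → ℝ, adjForm G y ≤ ρ * ∑ a, y a ^ 2) ∧
    graphSpectralRadius G = ENNReal.ofReal ρ := by
  classical
  have hcomp : IsCompact {x : W → ℝ | ∑ a, x a ^ 2 = 1} := by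
    refine Metric.isCompact_of_isClosed_isBounded
      (isClosed_eq (by fun_prop) continuous_const) ?_
    refine (Metric.isBounded_closedBall (x := (0 : W → ℝ)) (r := 1)).subset fun x hx => ?_
    rw [mem_closedBall_zero_iff, pi_norm_le_iff_of_nonneg zero_le_one]
    intro a
    have h1 : x a ^ 2 ≤ 1 := by
      rw [← (show ∑ a, x a ^ 2 = 1 from hx)]
      exact Finset.single_le_sum (f := fun a => x a ^ 2) (fun b _ => sq_nonneg _) (Finset.mem_univ a)
    rw [Real.norm_eq_abs]
    exact (sq_le_one_iff_abs_le_one _).1 h1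
  obtain ⟨x₀, hx₀, hmax⟩ := hcomp.exists_isMaxOn
    ⟨Pi.single (Classical.arbitrary W) 1, by
      simp [Pi.single_apply]⟩
    (continuous_adjForm G).continuousOn
  have hx1 : ∑ a, |x₀| a ^ 2 = 1 := by simpa [sq_abs] using hx₀
  have hmax' : ∀ y : W → ℝ, ∑ a, y a ^ 2 = 1 → adjForm G y ≤ adjForm G |x₀| := fun y hy =>
    (hmax hy).trans ((le_abs_self _).trans (abs_adjForm_le G x₀))
  set x := |x₀| with hxdef
  set ρ := adjForm G x with hρ
  have hx0 : ∀ a, 0 ≤ x a := fun a => abs_nonneg _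
  have hρ0 : 0 ≤ ρ := Finset.sum_nonneg fun a _ => mul_nonneg (hx0 a)
    (Finset.sum_nonneg fun b _ => by split_ifs; exacts [hx0 b, le_rfl])
  have hray : ∀ y : W → ℝ, adjForm G y ≤ ρ * ∑ a, y a ^ 2 := by
    intro y
    set s := ∑ a, y a ^ 2 with hs
    have hs0 : 0 ≤ s := Finset.sum_nonneg fun a _ => sq_nonneg _
    rcases hs0.eq_or_lt with h | h
    · have hy : y = 0 := by
        ext a
        have := (Finset.sum_eq_zero_iff_of_nonneg (fun a _ => sq_nonneg (y a))).1 h.symm a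
          (Finset.mem_univ a)
        simpa using this
      rw [← h, hy]
      simp [adjForm]
    · have h1 := hmax' ((Real.sqrt s)⁻¹ • y) (by
        simp only [Pi.smul_apply, smul_eq_mul, mul_pow, ← Finset.mul_sum, inv_pow,
          Real.sq_sqrt hs0]
        exact inv_mul_cancel₀ h.ne')
      rw [adjForm_smul, inv_pow, Real.sq_sqrt hs0, inv_mul_le_iff₀ h] at h1
      linarith
  have heig : ∀ a, adjApply G x a = ρ * x a := by
    set z : W → ℝ := fun a => adjApply G x a - ρ * x a with hz
    -- First variation of the Rayleigh inequality at the maximizer x in the direction of the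
    -- residual z = Ax - ρx; the term linear in t forces z = 0.
    have hzz : ∀ t : ℝ, 2 * t * ∑ a, z a ^ 2 + t ^ 2 * (adjForm G z - ρ * ∑ a, z a ^ 2) ≤ 0 := by
      intro t
      have h1 := hray (x + t • z)
      rw [adjForm_add, adjForm_smul] at h1
      have h2 : ∑ a, (x + t • z) a ^ 2 = 1 + 2 * t * ∑ a, x a * z a + t ^ 2 * ∑ a, z a ^ 2 := by
        rw [← hx1, Finset.mul_sum, Finset.mul_sum, ← Finset.sum_add_distrib,
          ← Finset.sum_add_distrib]
        exact Finset.sum_congr rfl fun a _ => by simp; ring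
      have h3 : ∑ a, (t • z) a * adjApply G x a =
          t * (∑ a, z a ^ 2 + ρ * ∑ a, x a * z a) := by
        rw [Finset.mul_sum, ← Finset.sum_add_distrib, Finset.mul_sum]
        exact Finset.sum_congr rfl fun a _ => by simp only [hz, Pi.smul_apply, smul_eq_mul]; ring
      rw [h2, h3] at h1
      linarith
    have hz0 : ∑ a, z a ^ 2 = 0 := by
      set s := ∑ a, z a ^ 2
      have hs0 : 0 ≤ s := Finset.sum_nonneg fun a _ => sq_nonneg _
      set K := adjForm G z - ρ * s
      by_contra hne
      have hpos : 0 < s := lt_of_le_of_ne hs0 (Ne.symm hne)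
      -- A step this short lets the linear term dominate K t².
      have h1 := hzz (s / (|K| + 1))
      have hK : 0 < |K| + 1 := by positivity
      have h2 : 2 * (s / (|K| + 1)) * s + (s / (|K| + 1)) ^ 2 * K =
          s ^ 2 * (2 * (|K| + 1) + K) / (|K| + 1) ^ 2 := by field_simp
      rw [h2] at h1
      have : 0 < s ^ 2 * (2 * (|K| + 1) + K) / (|K| + 1) ^ 2 := by
        have := neg_abs_le K
        have h0 := abs_nonneg K
        apply div_pos (mul_pos (by positivity) (by linarith)) (by positivity)
      linarith
    intro a
    have := (Finset.sum_eq_zero_iff_of_nonneg (fun a _ => sq_nonneg (z a))).1 hz0 a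
      (Finset.mem_univ a)
    have : z a = 0 := by simpa using this
    simp only [hz] at this
    linarith
  refine ⟨x, ρ, hρ0, hx0, hx1, heig, hray, ?_⟩
  unfold graphSpectralRadius spectralRadius
  have hmem : ∀ k : ℝ, k ∈ spectrum ℝ (G.adjMatrix ℝ) ↔
      ∃ v : W → ℝ, v ≠ 0 ∧ adjApply G v = k • v := by
    intro k
    rw [← Matrix.spectrum_toLin', ← Module.End.hasEigenvalue_iff_mem_spectrum]
    constructor
    · intro h
      obtain ⟨v, hv⟩ := h.exists_hasEigenvector
      exact ⟨v, hv.2, by simpa [adjApply_eq_mulVec] using hv.apply_eq_smul⟩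
    · rintro ⟨v, hv, h⟩
      exact Module.End.hasEigenvalue_of_hasEigenvector (x := v)
        ⟨Module.End.mem_eigenspace_iff.2 (by simpa [adjApply_eq_mulVec] using h), hv⟩
  apply le_antisymm
  · refine iSup₂_le fun k hk => ?_
    obtain ⟨v, hv, h⟩ := (hmem k).1 hk
    have h1 : adjForm G v = k * ∑ a, v a ^ 2 := by
      rw [adjForm, h, Finset.mul_sum]
      exact Finset.sum_congr rfl fun a _ => by simp; ring
    have h2 := (abs_adjForm_le G v).trans (hray |v|)
    have h3 : 0 < ∑ a, v a ^ 2 := by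
      obtain ⟨a, ha⟩ := Function.ne_iff.1 hv
      exact Finset.sum_pos' (fun b _ => sq_nonneg _) ⟨a, Finset.mem_univ _, by
        have : v a ≠ 0 := ha
        positivity⟩
    rw [h1, abs_mul, abs_of_pos h3] at h2
    simp only [Pi.abs_apply, sq_abs] at h2
    have h4 : |k| ≤ ρ := le_of_mul_le_mul_right h2 h3
    rw [← ENNReal.ofReal_coe_nnreal]
    exact ENNReal.ofReal_le_ofReal (by simpa using h4)
  · have hρm : ρ ∈ spectrum ℝ (G.adjMatrix ℝ) := (hmem ρ).2 ⟨x, by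
      rintro h
      simp [h] at hx1, funext fun a => heig a⟩
    refine le_trans ?_ (le_iSup₂ (f := fun k (_ : k ∈ spectrum ℝ (G.adjMatrix ℝ)) =>
      (‖k‖₊ : ENNReal)) ρ hρm)
    rw [← ENNReal.ofReal_coe_nnreal]
    exact ENNReal.ofReal_le_ofReal (by simpa using le_abs_self ρ)

end

/-! ### The Perron vector of a sparse graph -/

section

variable {W : Type w}

open Classical in
theorem natCast_degSum (G : SimpleGraph W) (Z : Finset W) :
    (degSum G Z : ℝ) = ∑ a ∈ Z, ∑ b ∈ Z, if G.Adj a b then 1 else 0 := by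
  simp [degSum, degIn]

open Classical in
/-- In a locally sparse graph the sum over the edges of the smaller weight is bounded by the
total weight. -/
theorem sum_min_le_of_degSum_le {G : SimpleGraph W} {C : ℕ}
    (hC : ∀ Z : Finset W, degSum G Z ≤ C * Z.card) (Z : Finset W) (f : W → ℝ)
    (hf : ∀ a ∈ Z, 0 ≤ f a) :
    (∑ a ∈ Z, ∑ b ∈ Z, if G.Adj a b then min (f a) (f b) else 0) ≤ C * ∑ a ∈ Z, f a := by
  induction hk : Z.card generalizing Z f with
  | zero => simp [Finset.card_eq_zero.1 hk]
  | succ k ih =>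
    obtain ⟨u, hu, hmin⟩ := Finset.exists_min_image Z f (Finset.card_pos.1 (by omega))
    -- Layer-cake argument: lowering all weights by the minimum f u costs f u times the degree sum,
    -- at most C |Z| f u, and u then drops out with weight 0.
    have h1 := ih (Z.erase u) (fun a => f a - f u)
      (fun a ha => sub_nonneg.2 (hmin a (Finset.mem_of_mem_erase ha)))
      (by rw [Finset.card_erase_of_mem hu, hk]; rfl)
    have h2 : ∀ a ∈ Z, ∀ b ∈ Z, (if G.Adj a b then min (f a) (f b) else 0) =
        (if G.Adj a b then min (f a - f u) (f b - f u) else 0) +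
          f u * (if G.Adj a b then 1 else 0) := by
      intro a _ b _
      split_ifs
      · rw [min_sub_sub_right]; ring
      · ring
    have h3 : (∑ a ∈ Z, ∑ b ∈ Z, if G.Adj a b then min (f a - f u) (f b - f u) else 0) =
        ∑ a ∈ Z.erase u, ∑ b ∈ Z.erase u,
          if G.Adj a b then min (f a - f u) (f b - f u) else 0 := by
      symm
      refine (Finset.sum_congr rfl fun a ha => ?_).trans
        (Finset.sum_subset (Finset.erase_subset u Z) fun a ha hau => ?_)
      · refine Finset.sum_subset (Finset.erase_subset u Z) fun b hb hbu => ?_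
        have hbu : b = u := by simpa [hb] using hbu
        subst hbu
        have := hmin a (Finset.mem_of_mem_erase ha)
        simp [this]
      · have hau : a = u := by simpa [ha] using hau
        subst hau
        refine Finset.sum_eq_zero fun b hb => ?_
        simp [hmin b hb]
    have h4 : ∑ a ∈ Z.erase u, (f a - f u) = ∑ a ∈ Z, f a - Z.card * f u := by
      have := Finset.add_sum_erase Z (fun a => f a - f u) hu
      rw [sub_self, zero_add] at this
      rw [this, Finset.sum_sub_distrib]
      simp
    have h5 : (degSum G Z : ℝ) ≤ C * Z.card := by exact_mod_cast hC Z
    rw [Finset.sum_congr rfl fun a ha => Finset.sum_congr rfl fun b hb => h2 a ha b hb]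
    simp only [Finset.sum_add_distrib, ← Finset.mul_sum]
    rw [h3, ← natCast_degSum]
    rw [h4] at h1
    have h6 := mul_le_mul_of_nonneg_left h5 (hf u hu)
    linarith

/-- If no `γ + 1` vertices have `m` common neighbours, then few vertices have more than `γ`
neighbours in `D`. -/
theorem card_filter_degIn_le [Fintype W] {G : SimpleGraph W} {γ m : ℕ}
    (hK : ∀ A M : Finset W, A.card = γ + 1 → (∀ a ∈ A, ∀ r ∈ M, G.Adj a r) → M.card ≤ m)
    (D : Finset W) : (Finset.univ.filter fun v => γ < degIn G D v).card ≤ 2 ^ D.card * m := by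
  classical
  -- A vertex with more than γ neighbours in D is a common neighbour of some (γ + 1)-subset of D,
  -- and each such subset accounts for at most m vertices.
  have hsub : (Finset.univ.filter fun v => γ < degIn G D v) ⊆
      D.powerset.biUnion fun A => Finset.univ.filter fun v => A.card = γ + 1 ∧ ∀ a ∈ A, G.Adj a v := by
    intro v hv
    simp only [Finset.mem_filter, Finset.mem_univ, true_and] at hv
    obtain ⟨A, hA, hAc⟩ := Finset.exists_subset_card_eq (n := γ + 1) hv
    simp only [Finset.mem_biUnion, Finset.mem_powerset, Finset.mem_filter, Finset.mem_univ, true_and]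
    refine ⟨A, fun a ha => (Finset.mem_filter.1 (hA ha)).1, hAc, fun a ha => ?_⟩
    exact (Finset.mem_filter.1 (hA ha)).2.symm
  refine (Finset.card_le_card hsub).trans ?_
  rw [← Finset.card_powerset]
  refine Finset.card_biUnion_le_card_mul _ _ _ fun A _ => ?_
  by_cases hA : A.card = γ + 1
  · refine hK A _ hA fun a ha r hr => (Finset.mem_filter.1 hr).2.2 a ha
  · simp [hA]

end

section

variable {W : Type w} [Fintype W]

theorem le_one_of_sum_sq_eq_one {x : W → ℝ} (h1 : ∑ a, x a ^ 2 = 1) (a : W) : x a ≤ 1 := by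
  have : x a ^ 2 ≤ 1 := by
    rw [← h1]
    exact Finset.single_le_sum (f := fun a => x a ^ 2) (fun b _ => sq_nonneg _) (Finset.mem_univ a)
  nlinarith [sq_nonneg (x a - 1)]

theorem sum_le_sqrt_card {x : W → ℝ} (h1 : ∑ a, x a ^ 2 = 1) (Z : Finset W) :
    ∑ a ∈ Z, x a ≤ √(Fintype.card W) := by
  apply Real.le_sqrt_of_sq_le
  have h2 := sq_sum_le_card_mul_sum_sq (s := Z) (f := x)
  have h3 : ∑ a ∈ Z, x a ^ 2 ≤ 1 := by
    rw [← h1]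
    exact Finset.sum_le_sum_of_subset_of_nonneg (Finset.subset_univ _) fun _ _ _ => sq_nonneg _
  have h4 : (Z.card : ℝ) ≤ Fintype.card W := by exact_mod_cast Finset.card_le_univ Z
  nlinarith [(Nat.cast_nonneg Z.card : (0 : ℝ) ≤ Z.card)]

theorem card_filter_le_of_sum_sq_eq_one {x : W → ℝ} (h1 : ∑ a, x a ^ 2 = 1) {δ : ℝ}
    (hδ : 0 < δ) : ((Finset.univ.filter fun a => δ ≤ x a).card : ℝ) ≤ 1 / δ ^ 2 := by
  rw [le_div_iff₀ (by positivity), ← h1, ← nsmul_eq_mul]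
  refine (Finset.card_nsmul_le_sum _ (fun a => x a ^ 2) _ fun a ha => ?_).trans
    (Finset.sum_le_sum_of_subset_of_nonneg (Finset.subset_univ _) fun _ _ _ => sq_nonneg _)
  have := (Finset.mem_filter.1 ha).2
  gcongr

open Classical in
/-- The quadratic form is almost carried by the edges between the set `D` of large entries and the
vertices outside `D` with at most `γ` neighbours in `D`. -/
theorem adjForm_le_of_sparse {G : SimpleGraph W} {C γ m : ℕ}
    (hC : ∀ Z : Finset W, degSum G Z ≤ C * Z.card)
    (hK : ∀ A M : Finset W, A.card = γ + 1 → (∀ a ∈ A, ∀ r ∈ M, G.Adj a r) → M.card ≤ m)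
    {x : W → ℝ} (hx : ∀ a, 0 ≤ x a) (h1 : ∑ a, x a ^ 2 = 1) {δ : ℝ} (hδ : 0 ≤ δ) (D : Finset W)
    (hD : ∀ a ∉ D, x a ≤ δ) :
    adjForm G x ≤ C * δ * √(Fintype.card W) +
      (D.card ^ 2 + 2 * (2 ^ D.card * m) * D.card : ℕ) +
      2 * ∑ v ∈ Dᶜ.filter (fun v => degIn G D v ≤ γ),
        x v * ∑ u ∈ D, if G.Adj v u then x u else 0 := by
  have hx1 := le_one_of_sum_sq_eq_one h1
  let e : W → W → ℝ := fun a b => if G.Adj a b then x a * x b else 0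
  have he : ∀ a b, e a b = e b a := fun a b => by simp [e, G.adj_comm a b, mul_comm]
  have h0 : adjForm G x = ∑ a, ∑ b, e a b := by
    simp only [adjForm, adjApply, Finset.mul_sum, e, mul_ite, mul_zero]
  have hsplit : ∀ f : W → ℝ, ∑ a, f a = ∑ a ∈ D, f a + ∑ a ∈ Dᶜ, f a := fun f =>
    (Finset.sum_add_sum_compl D f).symm
  have hmix : ∑ a ∈ D, ∑ b ∈ Dᶜ, e a b = ∑ a ∈ Dᶜ, ∑ b ∈ D, e a b := by
    rw [Finset.sum_comm]
    exact Finset.sum_congr rfl fun a _ => Finset.sum_congr rfl fun b _ => he _ _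
  have h2 : adjForm G x = ∑ a ∈ D, ∑ b ∈ D, e a b + ∑ a ∈ Dᶜ, ∑ b ∈ Dᶜ, e a b +
      2 * ∑ a ∈ Dᶜ, ∑ b ∈ D, e a b := by
    rw [h0, hsplit]
    simp only [hsplit (e _), Finset.sum_add_distrib]
    rw [hmix]
    ring
  have he1 : ∀ a b, e a b ≤ 1 := by
    intro a b
    simp only [e]
    split_ifs
    · exact mul_le_one₀ (hx1 a) (hx b) (hx1 b)
    · exact zero_le_one
  have hDD : ∑ a ∈ D, ∑ b ∈ D, e a b ≤ (D.card : ℝ) ^ 2 := by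
    calc _ ≤ ∑ a ∈ D, ∑ b ∈ D, (1 : ℝ) :=
          Finset.sum_le_sum fun a _ => Finset.sum_le_sum fun b _ => he1 a b
      _ = _ := by simp [sq]
  have hout : ∑ a ∈ Dᶜ, ∑ b ∈ Dᶜ, e a b ≤ C * δ * √(Fintype.card W) := by
    -- Outside D the larger factor of each product is at most δ, leaving the smaller one for the
    -- layer-cake bound.
    have h3 : ∑ a ∈ Dᶜ, ∑ b ∈ Dᶜ, e a b ≤
        δ * ∑ a ∈ Dᶜ, ∑ b ∈ Dᶜ, if G.Adj a b then min (x a) (x b) else 0 := by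
      simp only [Finset.mul_sum]
      refine Finset.sum_le_sum fun a ha => Finset.sum_le_sum fun b hb => ?_
      have ha' := hD a (Finset.mem_compl.1 ha)
      have hb' := hD b (Finset.mem_compl.1 hb)
      simp only [e]
      split_ifs
      · rcases le_total (x a) (x b) with h | h
        · rw [min_eq_left h, mul_comm]; exact mul_le_mul_of_nonneg_right hb' (hx a)
        · rw [min_eq_right h]; exact mul_le_mul_of_nonneg_right ha' (hx b)
      · simp
    have h4 := sum_min_le_of_degSum_le hC Dᶜ x fun a _ => hx a
    have h5 := sum_le_sqrt_card h1 Dᶜ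
    calc _ ≤ δ * (C * ∑ a ∈ Dᶜ, x a) := h3.trans (mul_le_mul_of_nonneg_left h4 hδ)
      _ ≤ δ * (C * √(Fintype.card W)) := by gcongr
      _ = _ := by ring
  have hX : ∑ a ∈ Dᶜ, ∑ b ∈ D, e a b ≤ (2 ^ D.card * m : ℝ) * D.card +
      ∑ v ∈ Dᶜ.filter (fun v => degIn G D v ≤ γ), x v * ∑ u ∈ D, if G.Adj v u then x u else 0 := by
    rw [← Finset.sum_filter_add_sum_filter_not Dᶜ (fun v => degIn G D v ≤ γ), add_comm]
    refine add_le_add ?_ (le_of_eq ?_)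
    · calc _ ≤ ∑ a ∈ Dᶜ.filter (fun v => ¬ degIn G D v ≤ γ), (D.card : ℝ) :=
            Finset.sum_le_sum fun a _ => by
              simpa using Finset.sum_le_card_nsmul D (e a) 1 fun b _ => he1 a b
        _ = (Dᶜ.filter (fun v => ¬ degIn G D v ≤ γ)).card * (D.card : ℝ) := by simp
        _ ≤ _ := by
            have h3 : (Dᶜ.filter (fun v => ¬ degIn G D v ≤ γ)).card ≤ 2 ^ D.card * m :=
              (Finset.card_le_card fun v hv => by simp at hv ⊢; exact hv.2).trans
                (card_filter_degIn_le hK D)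
            have h4 : ((Dᶜ.filter (fun v => ¬ degIn G D v ≤ γ)).card : ℝ) ≤ 2 ^ D.card * m := by
              exact_mod_cast h3
            gcongr
    · refine Finset.sum_congr rfl fun a _ => ?_
      simp only [e, Finset.mul_sum, mul_ite, mul_zero]
  rw [h2]
  push_cast
  linarith

set_option maxHeartbeats 1000000 in
open Classical in
/-- Near-equality in the Cauchy-Schwarz bound for the edges between `D` and `Y` forces `γ` large
entries in `D`, whose common neighbours are almost all vertices. -/
theorem exists_large_entries {G : SimpleGraph W} {γ : ℕ} (hγ : 1 ≤ γ)
    {x : W → ℝ} (hx : ∀ a, 0 ≤ x a) (h1 : ∑ a, x a ^ 2 = 1) {D Y : Finset W}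
    (hDY : Disjoint D Y) (hY : ∀ v ∈ Y, degIn G D v ≤ γ) {θ : ℝ} (hθ : 0 < θ)
    (hθγ : θ ≤ 1 / (16 * γ ^ 2)) (hn : 0 < Fintype.card W)
    (hE : (1 - θ ^ 2 / 4) * √(γ * Fintype.card W) ≤
      2 * ∑ v ∈ Y, x v * ∑ u ∈ D, if G.Adj v u then x u else 0) :
    ∃ L ⊆ D, L.card = γ ∧ (∀ a ∈ L, 1 / (4 * γ : ℝ) ≤ x a) ∧ (∀ a ∈ D, a ∉ L → x a ≤ θ) ∧
      ((Y.filter fun v => ∃ a ∈ L, ¬ G.Adj a v).card : ℝ) ≤ θ ^ 2 * γ * Fintype.card W := by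
  set n : ℝ := ((Fintype.card W : ℕ) : ℝ) with hndef
  have hn0 : 0 < n := Nat.cast_pos.2 hn
  have hγ1 : (1 : ℝ) ≤ γ := by exact_mod_cast hγ
  have hγ0 : (0 : ℝ) < γ := by linarith
  have hθ1 : θ ≤ 1 / 16 := hθγ.trans (by
    apply one_div_le_one_div_of_le (by norm_num); nlinarith)
  have hθγ2 : θ * γ ≤ 1 / (16 * γ) := by
    calc θ * γ ≤ 1 / (16 * γ ^ 2) * γ := by gcongr
      _ = 1 / (16 * γ) := by field_simp
  set η := θ ^ 2 / 4 with hη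
  have hη0 : 0 < η := by positivity
  have hη1 : η ≤ 1 / 16 := by rw [hη]; nlinarith
  let N : W → Finset W := fun v => D.filter (G.Adj v)
  set s : W → ℝ := fun v => ∑ u ∈ N v, x u with hs
  have hs' : ∀ v, (∑ u ∈ D, if G.Adj v u then x u else 0) = s v := fun v =>
    (Finset.sum_filter _ _).symm
  simp only [hs'] at hE
  set q := ∑ u ∈ D, x u ^ 2 with hq
  set T := ∑ v ∈ Y, s v ^ 2 with hT
  have hq0 : 0 ≤ q := Finset.sum_nonneg fun _ _ => sq_nonneg _
  have hYq : ∑ v ∈ Y, x v ^ 2 ≤ 1 - q := by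
    rw [le_sub_iff_add_le, ← h1, add_comm, ← Finset.sum_union hDY]
    exact Finset.sum_le_sum_of_subset_of_nonneg (Finset.subset_univ _) fun _ _ _ => sq_nonneg _
  have hT0 : 0 ≤ T := Finset.sum_nonneg fun _ _ => sq_nonneg _
  have hYn : (Y.card : ℝ) ≤ n := Nat.cast_le.2 (Finset.card_le_univ Y)
  -- Here q is the mass of x on D, so Y carries mass at most 1 - q. Together with s v² ≤ γq this
  -- gives 1 - 2η ≤ 4q(1 - q), which keeps q away from 0.
  have hCS : (1 - 2 * η) * γ * n ≤ 4 * (1 - q) * T := by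
    have h2 := Finset.sum_mul_sq_le_sq_mul_sq Y x s
    have h3 : ((1 - η) * √(γ * n)) ^ 2 ≤ (2 * ∑ v ∈ Y, x v * s v) ^ 2 :=
      pow_le_pow_left₀ (mul_nonneg (by linarith) (Real.sqrt_nonneg _)) hE 2
    rw [mul_pow, Real.sq_sqrt (by positivity), mul_pow] at h3
    have h4 : (∑ v ∈ Y, x v ^ 2) * T ≤ (1 - q) * T := by gcongr
    have h5 : (1 - 2 * η) * (γ * n) ≤ (1 - η) ^ 2 * (γ * n) := by
      apply mul_le_mul_of_nonneg_right _ (by positivity)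
      nlinarith [sq_nonneg η]
    nlinarith
  have hsv : ∀ v ∈ Y, s v ^ 2 ≤ γ * q := by
    intro v hv
    have h2 := sq_sum_le_card_mul_sum_sq (s := N v) (f := x)
    have h3 : ((N v).card : ℝ) ≤ γ := by exact_mod_cast hY v hv
    have h4 : ∑ u ∈ N v, x u ^ 2 ≤ q :=
      Finset.sum_le_sum_of_subset_of_nonneg (Finset.filter_subset _ _) fun _ _ _ => sq_nonneg _
    calc _ ≤ _ := h2
      _ ≤ γ * q := by gcongr
  have hTle : T ≤ n * (γ * q) := by
    calc T ≤ Y.card * (γ * q) := by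
          rw [← nsmul_eq_mul]; exact Finset.sum_le_card_nsmul _ _ _ hsv
      _ ≤ _ := by gcongr
  have hq1 : q ≤ 1 := by linarith [Finset.sum_nonneg (s := Y) fun v _ => sq_nonneg (x v)]
  have hq8 : 1 / 8 ≤ q := by
    have h2 : (1 - 2 * η) * γ * n ≤ 4 * (1 - q) * (n * (γ * q)) :=
      hCS.trans (mul_le_mul_of_nonneg_left hTle (by linarith))
    have h3 : (1 - 2 * η) * (γ * n) ≤ (4 * (1 - q) * q) * (γ * n) := by linarith
    have h4 := le_of_mul_le_mul_right h3 (by positivity)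
    nlinarith
  have hqpos : 0 < q := by linarith
  have hTge : n * ((1 - 2 * η) * (γ * q)) ≤ T := by
    have h2 : (1 - 2 * η) * γ * n * q ≤ 4 * (1 - q) * T * q := by gcongr
    have h3 : 4 * (1 - q) * T * q ≤ T := by
      have : 0 ≤ T * (1 - 2 * q) ^ 2 := by positivity
      nlinarith
    linarith
  -- As 4q(1 - q) ≤ 1, the values s v² average nearly their upper bound γq. A vertex v at or above
  -- the average has as neighbours in D the desired set L.
  obtain ⟨v, hv, hvs⟩ : ∃ v ∈ Y, (1 - 2 * η) * (γ * q) ≤ s v ^ 2 := by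
    have hpos : 0 < (1 - 2 * η) * (γ * q) := mul_pos (by linarith) (by positivity)
    have hYne : Y.Nonempty := by
      by_contra h
      rw [Finset.not_nonempty_iff_eq_empty] at h
      have : T = 0 := by simp [hT, h]
      have := mul_pos hn0 hpos
      linarith
    refine Finset.exists_le_of_sum_le hYne ?_
    rw [Finset.sum_const, nsmul_eq_mul]
    exact le_trans (by gcongr) hTge
  set L := N v with hL
  have hLD : L ⊆ D := Finset.filter_subset _ _
  have hLγ : L.card ≤ γ := hY v hv
  -- The common value of the entries on L in the case of equality.
  set p := √(q / γ) with hp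
  have hp2 : p ^ 2 * γ = q := by rw [hp, Real.sq_sqrt (by positivity)]; field_simp
  have hp0 : 0 ≤ p := Real.sqrt_nonneg _
  have hp3 : 1 / (3 * γ) ≤ p := by
    apply Real.le_sqrt_of_sq_le
    rw [div_pow, div_le_div_iff₀ (by positivity) hγ0]
    nlinarith
  have hsp : (1 - 2 * η) * (γ * p) ≤ s v := by
    have hs0 : 0 ≤ s v := Finset.sum_nonneg fun u _ => hx u
    refine (pow_le_pow_iff_left₀ (mul_nonneg (by linarith) (by positivity)) hs0 two_ne_zero).1 ?_
    have h2 : ((1 - 2 * η) * (γ * p)) ^ 2 = (1 - 2 * η) * ((1 - 2 * η) * (γ * q)) := by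
      rw [← hp2]; ring
    rw [h2]
    refine le_trans (mul_le_of_le_one_left ?_ (by linarith)) hvs
    exact mul_nonneg (by linarith) (by positivity)
  have hdev : ∑ u ∈ L, (x u - p) ^ 2 ≤ q - 2 * (1 - 2 * η) * q + L.card * p ^ 2 := by
    have h2 : ∑ u ∈ L, (x u - p) ^ 2 = ∑ u ∈ L, x u ^ 2 - 2 * p * s v + L.card * p ^ 2 := by
      simp only [sub_sq, Finset.sum_add_distrib, Finset.sum_sub_distrib, Finset.sum_const,
        nsmul_eq_mul, hs, Finset.mul_sum]
      congr 2
      exact Finset.sum_congr rfl fun u _ => by ring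
    have h3 : ∑ u ∈ L, x u ^ 2 ≤ q :=
      Finset.sum_le_sum_of_subset_of_nonneg hLD fun _ _ _ => sq_nonneg _
    have h4 := mul_le_mul_of_nonneg_left hsp hp0
    nlinarith
  -- With at most γ - 1 elements in L, the bound `hdev` would be at most 4ηq - p², which is negative
  -- because 4ηq = θ²γp² is much smaller than p².
  have hLcard : L.card = γ := by
    by_contra hne
    have h2 : (L.card : ℝ) + 1 ≤ γ := by exact_mod_cast lt_of_le_of_ne hLγ hne
    have h3 : 0 ≤ ∑ u ∈ L, (x u - p) ^ 2 := Finset.sum_nonneg fun _ _ => sq_nonneg _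
    have h4 : (L.card : ℝ) * p ^ 2 ≤ (γ - 1) * p ^ 2 := by gcongr; linarith
    have h5 : θ * γ * p ^ 2 ≤ 1 / 16 * p ^ 2 := by
      gcongr
      refine hθγ2.trans (one_div_le_one_div_of_le (by norm_num) (by linarith))
    have h6 : 4 * η * q = θ * (θ * γ * p ^ 2) := by rw [← hp2, hη]; ring
    have h7 : θ * (θ * γ * p ^ 2) ≤ 1 / 16 * (1 / 16 * p ^ 2) := by gcongr
    have h8 : 0 < p ^ 2 := by
      by_contra h
      have : p ^ 2 = 0 := le_antisymm (not_lt.1 h) (sq_nonneg p)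
      rw [this] at hp2
      linarith
    linarith
  have hdev' : ∀ u ∈ L, (x u - p) ^ 2 ≤ θ ^ 2 := by
    intro u hu
    have h2 := Finset.single_le_sum (f := fun u => (x u - p) ^ 2) (fun _ _ => sq_nonneg _) hu
    rw [hLcard] at hdev
    have h3 : 4 * η * q ≤ θ ^ 2 := by rw [hη]; nlinarith [sq_nonneg θ]
    linarith
  have habs : ∀ u ∈ L, |x u - p| ≤ θ := fun u hu => abs_le_of_sq_le_sq (hdev' u hu) hθ.le
  have hDL : ∀ a ∈ D, a ∉ L → x a ≤ θ := by
    intro a ha haL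
    have h2 := sq_sum_le_card_mul_sum_sq (s := L) (f := x)
    rw [hLcard] at h2
    have h3 : (1 - 2 * η) * q ≤ ∑ u ∈ L, x u ^ 2 := by
      have : γ * ((1 - 2 * η) * q) ≤ γ * ∑ u ∈ L, x u ^ 2 := by
        refine le_trans (by linarith) (hvs.trans h2)
      exact le_of_mul_le_mul_left this hγ0
    have h4 : x a ^ 2 + ∑ u ∈ L, x u ^ 2 ≤ q := by
      rw [← Finset.sum_insert (f := fun u => x u ^ 2) haL]
      exact Finset.sum_le_sum_of_subset_of_nonneg
        (Finset.insert_subset ha hLD) fun _ _ _ => sq_nonneg _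
    refine (pow_le_pow_iff_left₀ (hx a) hθ.le two_ne_zero).1 ?_
    have h5 : 2 * η * q ≤ θ ^ 2 := by rw [hη]; nlinarith [sq_nonneg θ]
    linarith
  refine ⟨L, hLD, hLcard, ?_, hDL, ?_⟩
  · intro u hu
    have h2 := (abs_le.1 (habs u hu)).1
    have h3 : θ ≤ 1 / 16 * (1 / γ) := by
      refine hθγ.trans ?_
      rw [one_div, mul_inv, ← one_div, ← one_div]
      gcongr
      nlinarith
    have h4 : 1 / (3 * γ : ℝ) = 1 / 3 * (1 / γ) := by field_simp
    have h5 : 1 / (4 * γ : ℝ) = 1 / 4 * (1 / γ) := by field_simp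
    have h6 : (0 : ℝ) < 1 / γ := by positivity
    rw [h5]
    rw [h4] at hp3
    linarith
  · set B := Y.filter fun v => ∃ a ∈ L, ¬ G.Adj a v with hB
    -- Missing one vertex of L leaves at most γ - 1 entries near p and otherwise entries at most θ.
    -- The resulting deficit q/2 in s b² can occur only rarely, as T is nearly nγq.
    have hBs : ∀ b ∈ B, s b ^ 2 ≤ γ * q - q / 2 := by
      intro b hb
      obtain ⟨hbY, a, haL, hab⟩ := Finset.mem_filter.1 hb
      have hab : ¬ G.Adj b a := fun h => hab h.symm
      have h2 : s b = ∑ u ∈ (N b).filter (· ∈ L), x u + ∑ u ∈ (N b).filter (¬ · ∈ L), x u :=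
        (Finset.sum_filter_add_sum_filter_not _ _ _).symm
      have h3 : ∑ u ∈ (N b).filter (· ∈ L), x u ≤ (γ - 1) * (p + θ) := by
        have hc : ((N b).filter (· ∈ L)).card + 1 ≤ γ := by
          have : (N b).filter (· ∈ L) ⊆ L.erase a := by
            intro u hu
            obtain ⟨hu1, hu2⟩ := Finset.mem_filter.1 hu
            refine Finset.mem_erase.2 ⟨?_, hu2⟩
            rintro rfl
            exact hab (Finset.mem_filter.1 hu1).2
          have := Finset.card_le_card this
          have := Finset.card_erase_add_one haL
          omega
        have hc' : (((N b).filter (· ∈ L)).card : ℝ) + 1 ≤ γ := by exact_mod_cast hc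
        calc _ ≤ ((N b).filter (· ∈ L)).card • (p + θ) :=
              Finset.sum_le_card_nsmul _ _ _ fun u hu => by
                have := (abs_le.1 (habs u (Finset.mem_filter.1 hu).2)).2
                linarith
          _ = (((N b).filter (· ∈ L)).card : ℝ) * (p + θ) := nsmul_eq_mul _ _
          _ ≤ _ := by gcongr; linarith
      have h4 : ∑ u ∈ (N b).filter (¬ · ∈ L), x u ≤ γ * θ := by
        have hc : (((N b).filter (¬ · ∈ L)).card : ℝ) ≤ γ := by
          exact_mod_cast (Finset.card_filter_le _ _).trans (hY b hbY)
        calc _ ≤ ((N b).filter (¬ · ∈ L)).card • θ :=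
              Finset.sum_le_card_nsmul _ _ _ fun u hu =>
                hDL u (Finset.mem_filter.1 (Finset.mem_filter.1 hu).1).1 (Finset.mem_filter.1 hu).2
          _ = (((N b).filter (¬ · ∈ L)).card : ℝ) * θ := nsmul_eq_mul _ _
          _ ≤ _ := by gcongr
      have h5 : θ * γ ≤ p / 4 := by
        have : 1 / (16 * γ : ℝ) = 3 / 16 * (1 / (3 * γ)) := by field_simp
        rw [this] at hθγ2
        linarith
      have h6 : s b ≤ (γ - 1 / 2) * p := by rw [h2]; linarith
      have hs0 : 0 ≤ s b := Finset.sum_nonneg fun u _ => hx u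
      have h7 := pow_le_pow_left₀ hs0 h6 2
      have h8 : ((γ - 1 / 2) * p) ^ 2 ≤ γ * q - q / 2 := by
        rw [← hp2]; nlinarith [sq_nonneg p]
      linarith
    have h2 : T ≤ Y.card * (γ * q) - B.card * (q / 2) := by
      have h3 : T ≤ ∑ v ∈ Y, (γ * q - if v ∈ B then q / 2 else 0) := by
        refine Finset.sum_le_sum fun v hv => ?_
        split_ifs with h
        · exact hBs v h
        · simpa using hsv v hv
      rw [Finset.sum_sub_distrib, Finset.sum_const, nsmul_eq_mul, ← Finset.sum_filter,
        Finset.sum_const, nsmul_eq_mul, Finset.filter_mem_eq_inter,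
        Finset.inter_eq_right.2 (Finset.filter_subset _ _)] at h3
      exact h3
    have h3 : (Y.card : ℝ) * (γ * q) ≤ n * (γ * q) := by gcongr
    have h4 : B.card * (q / 2) ≤ (2 * η * (γ * n)) * q := by linarith
    have h5 : (B.card : ℝ) * q ≤ (4 * η * (γ * n)) * q := by linarith
    have h6 := le_of_mul_le_mul_right h5 hqpos
    rw [hη] at h6
    linarith

end

open Classical in
/-- Sparse graphs with large spectral radius: the Perron vector has exactly `γ` large entries, and
almost all vertices are common neighbours of the corresponding vertices. -/
theorem exists_dominating_candidates (γ m C : ℕ) (hγ : 1 ≤ γ) {μ : ℝ} (hμ : 0 < μ) :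
    ∃ n₀ : ℕ, ∀ {W : Type w} [Fintype W] (G : SimpleGraph W) (x : W → ℝ) (ρ : ℝ),
      n₀ ≤ Fintype.card W → (∀ Z : Finset W, degSum G Z ≤ C * Z.card) →
      (∀ A M : Finset W, A.card = γ + 1 → (∀ a ∈ A, ∀ r ∈ M, G.Adj a r) → M.card ≤ m) →
      (∀ a, 0 ≤ x a) → ∑ a, x a ^ 2 = 1 → 0 ≤ ρ → ρ ≤ adjForm G x →
      (γ * (Fintype.card W - γ) : ℝ) ≤ ρ ^ 2 →
      ∃ L : Finset W, L.card = γ ∧ (∀ a ∈ L, 1 / (4 * γ : ℝ) ≤ x a) ∧ (∀ a ∉ L, x a ≤ μ) ∧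
        ((Finset.univ.filter fun v => ∃ a ∈ L, ¬ G.Adj a v).card : ℝ) ≤ μ * Fintype.card W := by
  have hγ1 : (1 : ℝ) ≤ γ := by exact_mod_cast hγ
  have hγ0 : (0 : ℝ) < γ := by linarith
  -- Only half of μ is spent on the exceptions in Y; the other half covers D and the vertices with
  -- more than γ neighbours in D.
  obtain ⟨θ, hθ, hθγ, hθμ, hθμ'⟩ : ∃ θ : ℝ, 0 < θ ∧ θ ≤ 1 / (16 * γ ^ 2) ∧ θ ≤ μ ∧
      θ ^ 2 * γ ≤ μ / 2 := by
    refine ⟨min (1 / (16 * γ ^ 2)) (min μ 1 / (2 * γ)), ?_, min_le_left _ _, ?_, ?_⟩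
    · positivity
    · refine (min_le_right _ _).trans ?_
      rw [div_le_iff₀ (by positivity)]
      have := min_le_left μ 1
      nlinarith
    · set t := min (1 / (16 * γ ^ 2 : ℝ)) (min μ 1 / (2 * γ)) with ht
      have h0 : 0 < t := by positivity
      have h1 : t * (2 * γ) ≤ min μ 1 := by
        rw [← le_div_iff₀ (by positivity)]; exact min_le_right _ _
      have h2 : t ≤ 1 := by
        have := min_le_right μ 1
        nlinarith
      have h3 := min_le_left μ 1
      nlinarith
  obtain ⟨δ, hδ, hδμ, hδC⟩ : ∃ δ : ℝ, 0 < δ ∧ δ ≤ μ ∧ C * δ ≤ θ ^ 2 / 8 := by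
    refine ⟨min μ (θ ^ 2 / (8 * (C + 1))), by positivity, min_le_left _ _, ?_⟩
    calc (C : ℝ) * min μ (θ ^ 2 / (8 * (C + 1))) ≤ (C + 1) * (θ ^ 2 / (8 * (C + 1))) := by
          gcongr
          · linarith
          · exact min_le_right _ _
      _ = θ ^ 2 / 8 := by field_simp
  obtain ⟨d, hd⟩ := exists_nat_ge (1 / δ ^ 2)
  let K : ℕ := d ^ 2 + 2 * (2 ^ d * m) * d
  obtain ⟨n₁, hn₁⟩ := exists_nat_ge (((γ + K) / (θ ^ 2 / 8)) ^ 2)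
  obtain ⟨n₂, hn₂⟩ := exists_nat_ge ((d + 2 ^ d * m) / (μ / 2))
  refine ⟨max (max n₁ n₂) (γ + 1), fun {W} _ G x ρ hn hC hK hx h1 hρ0 hρ hργ => ?_⟩
  have hn1 : (n₁ : ℝ) ≤ Fintype.card W := by
    exact_mod_cast (le_max_left _ _).trans ((le_max_left _ _).trans hn)
  have hn2 : (n₂ : ℝ) ≤ Fintype.card W := by
    exact_mod_cast (le_max_right _ _).trans ((le_max_left _ _).trans hn)
  have hn3 : (γ : ℝ) + 1 ≤ Fintype.card W := by exact_mod_cast (le_max_right _ _).trans hn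
  have hpos : 0 < Fintype.card W := lt_of_lt_of_le (by omega) ((le_max_right _ _).trans hn)
  set D : Finset W := Finset.univ.filter fun a => δ ≤ x a with hD
  have hDd : D.card ≤ d := by
    exact_mod_cast (card_filter_le_of_sum_sq_eq_one h1 hδ).trans hd
  have hDx : ∀ a ∉ D, x a ≤ δ := by
    intro a ha
    by_contra h
    exact ha (by simp [hD, (not_le.1 h).le])
  set Y := Dᶜ.filter (fun v => degIn G D v ≤ γ) with hY
  have hXcard : (Finset.univ.filter fun v => γ < degIn G D v).card ≤ 2 ^ d * m :=
    (card_filter_degIn_le hK D).trans (by gcongr; norm_num)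
  have hE := adjForm_le_of_sparse hC hK hx h1 hδ.le D hDx
  rw [← hY] at hE
  set S := ∑ v ∈ Y, x v * ∑ u ∈ D, if G.Adj v u then x u else 0
  set n : ℝ := ((Fintype.card W : ℕ) : ℝ) with hndef
  have hn0 : 0 ≤ n := Nat.cast_nonneg _
  have hKD : ((D.card ^ 2 + 2 * (2 ^ D.card * m) * D.card : ℕ) : ℝ) ≤ K := by
    have : D.card ^ 2 + 2 * (2 ^ D.card * m) * D.card ≤ K := by
      simp only [K]
      gcongr
      norm_num
    exact_mod_cast this
  -- Because (√(γn) - γ)² ≤ γn - γ² once √(γn) ≥ γ.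
  have hsq : √(γ * n) - γ ≤ ρ := by
    have h2 : (γ : ℝ) ≤ √(γ * n) := Real.le_sqrt_of_sq_le (by nlinarith)
    refine (pow_le_pow_iff_left₀ (sub_nonneg.2 h2) hρ0 two_ne_zero).1 ?_
    refine le_trans ?_ hργ
    rw [sub_sq, Real.sq_sqrt (by positivity)]
    nlinarith
  have hsn : √n ≤ √(γ * n) := Real.sqrt_le_sqrt (by nlinarith)
  have hbig : (γ + K : ℝ) ≤ θ ^ 2 / 8 * √n := by
    rw [mul_comm, ← div_le_iff₀ (by positivity)]
    exact Real.le_sqrt_of_sq_le (hn₁.trans hn1)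
  -- Half of the slack (θ²/4)√(γn) absorbs the edges outside D, the other half the constants γ + K.
  have hES : (1 - θ ^ 2 / 4) * √(γ * n) ≤ 2 * S := by
    have h2 : C * δ * √n ≤ θ ^ 2 / 8 * √n := by gcongr
    have h3 : θ ^ 2 / 8 * √n ≤ θ ^ 2 / 8 * √(γ * n) := by gcongr
    linarith
  have hDY : Disjoint D Y :=
    Finset.disjoint_left.2 fun a ha haY => (Finset.mem_compl.1 (Finset.mem_filter.1 haY).1) ha
  obtain ⟨L, hLD, hLc, hLx, hDL, hB⟩ := exists_large_entries hγ hx h1 hDY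
    (fun v hv => (Finset.mem_filter.1 hv).2) hθ hθγ hpos hES
  refine ⟨L, hLc, hLx, fun a ha => ?_, ?_⟩
  · by_cases haD : a ∈ D
    · exact (hDL a haD ha).trans hθμ
    · exact (hDx a haD).trans hδμ
  · have hsub : (Finset.univ.filter fun v => ∃ a ∈ L, ¬ G.Adj a v) ⊆
        (Y.filter fun v => ∃ a ∈ L, ¬ G.Adj a v) ∪
          (D ∪ Finset.univ.filter fun v => γ < degIn G D v) := by
      intro v hv
      simp only [Finset.mem_union, Finset.mem_filter, Finset.mem_univ, true_and, hY,
        Finset.mem_compl] at hv ⊢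
      by_cases h2 : v ∈ D
      · exact Or.inr (Or.inl h2)
      · by_cases h3 : γ < degIn G D v
        · exact Or.inr (Or.inr h3)
        · exact Or.inl ⟨⟨h2, not_lt.1 h3⟩, hv⟩
    have hc := (Finset.card_le_card hsub).trans ((Finset.card_union_le _ _).trans
      (Nat.add_le_add_left ((Finset.card_union_le _ _).trans (Nat.add_le_add hDd hXcard)) _))
    have hc' : ((Finset.univ.filter fun v => ∃ a ∈ L, ¬ G.Adj a v).card : ℝ) ≤
        (Y.filter fun v => ∃ a ∈ L, ¬ G.Adj a v).card + (d + 2 ^ d * m) := by exact_mod_cast hc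
    have h2 : (d + 2 ^ d * m : ℝ) ≤ μ / 2 * n := by
      have := (div_le_iff₀ (by positivity)).1 (hn₂.trans hn2)
      linarith
    have h3 : θ ^ 2 * γ * n ≤ μ / 2 * n := by gcongr
    linarith

/-! ### Competitors obtained by joining a set to everything -/

/-- All edges incident to `L` are added to `G`. -/
def coneOn {W : Type w} (L : Finset W) (G : SimpleGraph W) : SimpleGraph W where
  Adj a b := a ≠ b ∧ (a ∈ L ∨ b ∈ L ∨ G.Adj a b)
  symm := ⟨fun a b h => ⟨h.1.symm, by
    rcases h.2 with h | h | h
    exacts [Or.inr (Or.inl h), Or.inl h, Or.inr (Or.inr h.symm)]⟩⟩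
  loopless := ⟨fun _ h => h.1 rfl⟩

theorem exists_induce_containsSubdivision_of_coneOn {V : Type v} [Fintype V] {W : Type w}
    {H : SimpleGraph V} {G : SimpleGraph W} {L : Finset W} (hL : L.card ≤ Fintype.card V)
    (h : ContainsSubdivision H (coneOn L G)) :
    ∃ S : Finset V, S.card + L.card = Fintype.card V ∧
      ContainsSubdivision (H.induce (S : Set V)) G := by
  obtain ⟨S, hS, hc⟩ := exists_induce_containsSubdivision h L
    (k := Fintype.card V - L.card) (by omega)
  refine ⟨S, by omega, hc.map ⟨Subtype.val, ?_⟩ Subtype.val_injective⟩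
  rintro a b ⟨-, h | h | h⟩
  exacts [absurd h a.2, absurd h b.2, h]

/-- This makes the modified graphs admissible competitors: a subdivision in one of them loses at
most |L| branch vertices on deleting L, and they are restored in G using only edges known to be
there. -/
theorem containsSubdivision_of_coneOn_restrictTo {V : Type v} [Fintype V] {W : Type w}
    {H : SimpleGraph V} {G : SimpleGraph W} {L M : Finset W} {Q : Set W}
    (hL : L.card ≤ Fintype.card V) (hM : ∀ a ∈ L, ∀ r ∈ M, G.Adj a r)
    (hMcard : Fintype.card (V ⊕ Sym2 V) ≤ M.card) (hQ : ∀ a ∈ L, ∀ r ∈ Q, G.Adj a r)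
    (hQM : ∀ r ∈ M, r ∉ Q) (h : ContainsSubdivision H (coneOn L (restrictTo G Q))) :
    ContainsSubdivision H G := by
  obtain ⟨S, hS, hc⟩ := exists_induce_containsSubdivision_of_coneOn hL h
  exact containsSubdivision_of_restrictTo hS hM hMcard hQ hQM hc

/-- Deleting L from such a subdivision would leave more than α(H) branch vertices in an edgeless
graph, hence too large an independent set of H. -/
theorem not_containsSubdivision_coneOn_bot {V : Type v} [Fintype V] {W : Type w}
    {H : SimpleGraph V} {L : Finset W} (hL : L.card + H.indepNum < Fintype.card V) :
    ¬ ContainsSubdivision H (coneOn L (⊥ : SimpleGraph W)) := by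
  intro h
  obtain ⟨S, hS, hc⟩ := exists_induce_containsSubdivision_of_coneOn (by omega) h
  have hind : H.IsIndepSet (S : Set V) := by
    intro x hx y hy _ hxy
    obtain ⟨φ, I, hφ, -, -, hl⟩ := containsSubdivision_iff.1 hc
    obtain ⟨c, hc⟩ := (hl ⟨x, hx⟩ ⟨y, hy⟩ hxy).exists_adj
      (hφ.ne fun h => hxy.ne (congrArg Subtype.val h))
    exact hc
  have := hind.card_le_indepNum
  omega

open Classical in
/-- The quadratic form on `Z` is at most the square root of the degree sum. -/
theorem sq_sum_edges_le {W : Type w} (G : SimpleGraph W) (x : W → ℝ) (Z : Finset W) :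
    (∑ a ∈ Z, ∑ b ∈ Z, if G.Adj a b then x a * x b else 0) ^ 2 ≤
      degSum G Z * (∑ a ∈ Z, x a ^ 2) ^ 2 := by
  have h := Finset.sum_mul_sq_le_sq_mul_sq (Z ×ˢ Z)
    (fun t => if G.Adj t.1 t.2 then (1 : ℝ) else 0) (fun t => x t.1 * x t.2)
  simp only [ite_mul, one_mul, zero_mul, ite_pow, one_pow, zero_pow two_ne_zero,
    Finset.sum_product, mul_pow, ← Finset.mul_sum, ← Finset.sum_mul] at h
  rw [natCast_degSum, sq (∑ a ∈ Z, x a ^ 2)]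
  exact h

section

variable {W : Type w} [Fintype W]

open Classical in
/-- Test vectors on a graph obtained from `G` by joining `L` to everything and deleting the edges of
`G - L` incident to `B ∪ F`. -/
theorem le_adjForm_coneOn_restrictTo {G : SimpleGraph W} {x : W → ℝ} {ρ τ : ℝ}
    (hx : ∀ a, 0 ≤ x a) (heig : ∀ a, adjApply G x a = ρ * x a) (hτ : 0 ≤ τ)
    {L B F : Finset W} (hLB : Disjoint L B) (hLF : Disjoint L F) :
    adjForm G x - 2 * ρ * ∑ a ∈ B, x a ^ 2 + 2 * B.card * (τ * ∑ a ∈ L, x a)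
      - 2 * (∑ a ∈ F, ∑ b ∈ Lᶜ, if G.Adj a b then x a * x b else 0)
      + (∑ a ∈ L, ∑ b ∈ L, if a ≠ b ∧ ¬ G.Adj a b then x a * x b else 0) ≤
    adjForm (coneOn L (restrictTo G {a | a ∉ L ∧ a ∉ B ∧ a ∉ F}))
      (fun a => if a ∈ B then τ else x a) := by
  set G' := coneOn L (restrictTo G {a | a ∉ L ∧ a ∉ B ∧ a ∉ F}) with hG'
  set y : W → ℝ := fun a => if a ∈ B then τ else x a with hy
  let e : W → W → ℝ := fun a b => if G.Adj a b then x a * x b else 0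
  have he0 : ∀ a b, 0 ≤ e a b := fun a b => by
    simp only [e]; split_ifs; exacts [mul_nonneg (hx a) (hx b), le_rfl]
  have hec : ∀ a b, e a b = e b a := fun a b => by simp [e, G.adj_comm a b, mul_comm]
  have hy0 : ∀ a, 0 ≤ y a := fun a => by simp only [hy]; split_ifs; exacts [hτ, hx a]
  -- The comparison is made pair by pair. A pair with both ends in B or both in F is subtracted more
  -- than once on the left, which only weakens the bound.
  have hpt : ∀ a b, e a b - (if a ∈ B then e a b else 0) - (if b ∈ B then e a b else 0)
      - (if a ∈ F then if b ∈ Lᶜ then e a b else 0 else 0)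
      - (if b ∈ F then if a ∈ Lᶜ then e a b else 0 else 0)
      + (if a ∈ L then if b ∈ L then (if a ≠ b ∧ ¬ G.Adj a b then x a * x b else 0) else 0 else 0)
      + (if a ∈ B then if b ∈ L then τ * x b else 0 else 0)
      + (if b ∈ B then if a ∈ L then τ * x a else 0 else 0) ≤
      (if G'.Adj a b then y a * y b else 0) := by
    intro a b
    have hadj : G'.Adj a b ↔ a ≠ b ∧ (a ∈ L ∨ b ∈ L ∨ G.Adj a b ∧
      (a ∉ L ∧ a ∉ B ∧ a ∉ F) ∧ (b ∉ L ∧ b ∉ B ∧ b ∉ F)) := Iff.rfl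
    have hLB' : ∀ c ∈ L, c ∉ B := fun c h h' => Finset.disjoint_left.1 hLB h h'
    have hLF' : ∀ c ∈ L, c ∉ F := fun c h h' => Finset.disjoint_left.1 hLF h h'
    have h0 := he0 a b
    have hxx := mul_nonneg (hx a) (hx b)
    have hyy := mul_nonneg (hy0 a) (hy0 b)
    by_cases haL : a ∈ L
    · have haB := hLB' a haL
      have haF := hLF' a haL
      by_cases hbL : b ∈ L
      · have hbB := hLB' b hbL
        have hbF := hLF' b hbL
        by_cases hab : a = b
        · subst hab; simp [e, haB, haF, haL]
        · by_cases hg : G.Adj a b <;> simp [hadj, e, haB, haF, haL, hbL, hbB, hbF, hab, hg, hy]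
      · have hab : a ≠ b := fun h => hbL (h ▸ haL)
        by_cases hbB : b ∈ B
        · by_cases hbF : b ∈ F <;> simp [hadj, haB, haF, haL, hbL, hbB, hbF, hab, hy] <;> linarith
        · by_cases hbF : b ∈ F <;> by_cases hg : G.Adj a b <;>
            simp [hadj, e, haB, haF, haL, hbL, hbB, hbF, hab, hy, hg, hxx]
    · by_cases hbL : b ∈ L
      · have hbB := hLB' b hbL
        have hbF := hLF' b hbL
        have hab : a ≠ b := fun h => haL (h ▸ hbL)
        by_cases haB : a ∈ B
        · by_cases haF : a ∈ F <;> simp [hadj, haB, haF, haL, hbL, hbB, hbF, hab, hy]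
        · by_cases haF : a ∈ F <;> by_cases hg : G.Adj a b <;>
            simp [hadj, e, haB, haF, haL, hbL, hbB, hbF, hab, hy, hg, hxx]
      · by_cases haB : a ∈ B
        · by_cases hbB : b ∈ B <;> by_cases haF : a ∈ F <;> by_cases hbF : b ∈ F <;>
            simp [hadj, haB, haF, haL, hbL, hbB, hbF] <;> linarith
        · by_cases hbB : b ∈ B <;> by_cases haF : a ∈ F <;> by_cases hbF : b ∈ F <;>
            by_cases hg : a ≠ b ∧ G.Adj a b
          all_goals first
            | simp [hadj, e, haB, haF, haL, hbL, hbB, hbF, hg, hy, hxx]; done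
            | simp [hadj, e, haB, haF, haL, hbL, hbB, hbF, hg]; linarith
            | (have hg' : ¬ G.Adj a b := fun h => hg ⟨h.ne, h⟩
               simp [hadj, e, haB, haF, haL, hbL, hbB, hbF, hg'])
  have hsum := Finset.sum_le_sum fun a (_ : a ∈ Finset.univ) =>
    Finset.sum_le_sum fun b (_ : b ∈ Finset.univ) => hpt a b
  have hBsum : ∑ a ∈ B, ∑ b, e a b = ρ * ∑ a ∈ B, x a ^ 2 := by
    rw [Finset.mul_sum]
    refine Finset.sum_congr rfl fun a _ => ?_
    have h1 : ∑ b, e a b = x a * adjApply G x a := by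
      simp only [adjApply, Finset.mul_sum, e, mul_ite, mul_zero]
    rw [h1, heig]
    ring
  have hGsum : ∑ a, ∑ b, e a b = adjForm G x := by
    simp only [adjForm, adjApply, Finset.mul_sum, e, mul_ite, mul_zero]
  have hG'sum : (∑ a, ∑ b, if G'.Adj a b then y a * y b else 0) = adjForm G' y := by
    simp only [adjForm, adjApply, Finset.mul_sum, mul_ite, mul_zero]
  have hpull : ∀ (Z : Finset W) (f : W → W → ℝ),
      (∑ a, ∑ b, if a ∈ Z then f a b else 0) = ∑ a ∈ Z, ∑ b, f a b := by
    intro Z f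
    have h1 : ∀ a, (∑ b, if a ∈ Z then f a b else 0) = if a ∈ Z then ∑ b, f a b else 0 := by
      intro a; split_ifs <;> simp
    simp only [h1, Finset.sum_ite_mem, Finset.univ_inter]
  have hin : ∀ (Z : Finset W) (f : W → ℝ), (∑ b, if b ∈ Z then f b else 0) = ∑ b ∈ Z, f b := by
    intro Z f
    rw [Finset.sum_ite_mem, Finset.univ_inter]
  have hB' : ∑ a, ∑ b ∈ B, e a b = ρ * ∑ a ∈ B, x a ^ 2 := by
    rw [Finset.sum_comm, ← hBsum]
    exact Finset.sum_congr rfl fun a _ => Finset.sum_congr rfl fun b _ => hec _ _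
  have hF' : (∑ a, ∑ b ∈ F, if a ∈ Lᶜ then e a b else 0) = ∑ a ∈ F, ∑ b ∈ Lᶜ, e a b := by
    rw [Finset.sum_comm]
    simp only [hin]
    exact Finset.sum_congr rfl fun a _ => Finset.sum_congr rfl fun b _ => hec _ _
  have hL' : (∑ a, ∑ b ∈ B, if a ∈ L then τ * x a else 0) = B.card * (τ * ∑ a ∈ L, x a) := by
    rw [Finset.sum_comm]
    simp only [hin, ← Finset.mul_sum, Finset.sum_const, nsmul_eq_mul]
    ring
  have hL : ∑ a ∈ B, ∑ b ∈ L, τ * x b = B.card * (τ * ∑ a ∈ L, x a) := by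
    simp only [← Finset.mul_sum, Finset.sum_const, nsmul_eq_mul]
    ring
  simp only [Finset.sum_add_distrib, Finset.sum_sub_distrib, hpull, hin] at hsum
  rw [hG'sum, hGsum, hBsum, hB', hF', hL', hL] at hsum
  linarith

end

/-! ### Spare vertices and the vertices missing a neighbour in L -/

section

variable {W : Type w} [Fintype W]

open Classical in
/-- A vertex outside `L` has few neighbours among the common neighbours of `L`. -/
theorem card_common_neighbors_le {G : SimpleGraph W} {γ m : ℕ}
    (hK : ∀ A M : Finset W, A.card = γ + 1 → (∀ a ∈ A, ∀ r ∈ M, G.Adj a r) → M.card ≤ m)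
    {L : Finset W} (hL : L.card = γ) {a : W} (ha : a ∉ L) :
    (Finset.univ.filter fun r => (∀ l ∈ L, G.Adj l r) ∧ G.Adj a r).card ≤ m := by
  refine hK (insert a L) _ (by rw [Finset.card_insert_of_notMem ha, hL]) fun b hb r hr => ?_
  obtain ⟨h1, h2⟩ := (Finset.mem_filter.1 hr).2
  rcases Finset.mem_insert.1 hb with rfl | hb
  exacts [h2, h1 b hb]

open Classical in
/-- Many common neighbours of `L` have small entries and no neighbours in the small set `B`. -/
theorem exists_spare_vertices {G : SimpleGraph W} {x : W → ℝ} (h1 : ∑ a, x a ^ 2 = 1)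
    {m k : ℕ} {μ : ℝ} (hμ : (m + 1) * μ ≤ 1 / 4) {L B : Finset W}
    (hB : ∀ b ∈ B, b ∉ L ∧ ∃ a ∈ L, ¬ G.Adj a b)
    (hm : ∀ a ∉ L, (Finset.univ.filter fun r => (∀ l ∈ L, G.Adj l r) ∧ G.Adj a r).card ≤ m)
    (hW : ((Finset.univ.filter fun v => ∃ a ∈ L, ¬ G.Adj a v).card : ℝ) ≤ μ * Fintype.card W)
    (hn : 0 < Fintype.card W) (hk : 2 * k ≤ Fintype.card W) :
    ∃ F : Finset W, F.card = k ∧ ∀ a ∈ F, (∀ l ∈ L, G.Adj l a) ∧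
      x a ≤ 2 / √(Fintype.card W) ∧ ∀ b ∈ B, ¬ G.Adj a b := by
  set n : ℝ := ((Fintype.card W : ℕ) : ℝ) with hndef
  have hn0 : 0 < n := Nat.cast_pos.2 hn
  set Z := Finset.univ.filter fun v => ∃ a ∈ L, ¬ G.Adj a v with hZ
  set F := Finset.univ.filter fun a => (∀ l ∈ L, G.Adj l a) ∧ x a ≤ 2 / √n ∧ ∀ b ∈ B, ¬ G.Adj a b
    with hF
  have hBZ : B ⊆ Z := fun b hb => by simp [hZ]; simpa using (hB b hb).2
  -- Unusable vertices: at most μn miss a neighbour in L, at most n/4 have entry at least 2/√n, and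
  -- at most m common neighbours of L are adjacent to each vertex of B. At least n/2 vertices
  -- remain.
  have hcov : (Finset.univ : Finset W) ⊆ F ∪ (Z ∪ ((Finset.univ.filter fun a => 2 / √n ≤ x a) ∪
      B.biUnion fun b => Finset.univ.filter fun r => (∀ l ∈ L, G.Adj l r) ∧ G.Adj b r)) := by
    intro a _
    simp only [Finset.mem_union, hF, hZ, Finset.mem_filter, Finset.mem_univ, true_and,
      Finset.mem_biUnion]
    by_cases ha : ∀ l ∈ L, G.Adj l a
    · by_cases hax : 2 / √n ≤ x a
      · exact Or.inr (Or.inr (Or.inl hax))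
      · by_cases hab : ∀ b ∈ B, ¬ G.Adj a b
        · exact Or.inl ⟨ha, (not_le.1 hax).le, hab⟩
        · push Not at hab
          obtain ⟨b, hb, hab⟩ := hab
          exact Or.inr (Or.inr (Or.inr ⟨b, hb, ha, hab.symm⟩))
    · push Not at ha
      exact Or.inr (Or.inl ha)
  have hbi : (B.biUnion fun b => Finset.univ.filter fun r =>
      (∀ l ∈ L, G.Adj l r) ∧ G.Adj b r).card ≤ Z.card * m :=
    (Finset.card_biUnion_le_card_mul _ _ m fun b hb => hm b (hB b hb).1).trans
      (Nat.mul_le_mul_right _ (Finset.card_le_card hBZ))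
  have hc := (Finset.card_le_card hcov).trans ((Finset.card_union_le _ _).trans
    (Nat.add_le_add_left ((Finset.card_union_le _ _).trans (Nat.add_le_add_left
      ((Finset.card_union_le _ _).trans (Nat.add_le_add_left hbi _)) _)) _))
  have hlarge := card_filter_le_of_sum_sq_eq_one h1 (δ := 2 / √n) (by positivity)
  have h4 : 1 / (2 / √n) ^ 2 = n / 4 := by
    rw [div_pow, Real.sq_sqrt hn0.le]; field_simp; norm_num
  rw [h4] at hlarge
  have hc' : n ≤ F.card + (Z.card + ((Finset.univ.filter fun a => 2 / √n ≤ x a).card +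
      Z.card * m)) := by
    rw [hndef, ← Finset.card_univ]
    exact_mod_cast hc
  have hZ' : (Z.card : ℝ) * (m + 1) ≤ n / 4 := by
    calc (Z.card : ℝ) * (m + 1) ≤ (μ * n) * (m + 1) := by gcongr
      _ = ((m + 1) * μ) * n := by ring
      _ ≤ 1 / 4 * n := by gcongr
      _ = n / 4 := by ring
  have hk' : (2 : ℝ) * k ≤ n := by rw [hndef]; exact_mod_cast hk
  have hkF : (k : ℝ) ≤ F.card := by linarith
  obtain ⟨F', hF', hF'c⟩ := Finset.exists_subset_card_eq (s := F) (n := k) (by exact_mod_cast hkF)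
  exact ⟨F', hF'c, fun a ha => (Finset.mem_filter.1 (hF' ha)).2⟩

open Classical in
/-- The edges of `G - L` at the spare vertices carry little weight. -/
theorem sum_edges_spare_le {G : SimpleGraph W} {x : W → ℝ} (hx : ∀ a, 0 ≤ x a) {m : ℕ} {μ ε : ℝ}
    {L B F : Finset W} (hB : ∀ b, b ∉ L → (∃ a ∈ L, ¬ G.Adj a b) → b ∈ B) (hμ0 : 0 ≤ μ)
    (hμ : ∀ a ∉ L, x a ≤ μ) (hε : 0 ≤ ε)
    (hm : ∀ a ∉ L, (Finset.univ.filter fun r => (∀ l ∈ L, G.Adj l r) ∧ G.Adj a r).card ≤ m)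
    (hF : ∀ a ∈ F, a ∉ L ∧ x a ≤ ε ∧ ∀ b ∈ B, ¬ G.Adj a b) :
    (∑ a ∈ F, ∑ b ∈ Lᶜ, if G.Adj a b then x a * x b else 0) ≤ F.card * (ε * (m * μ)) := by
  rw [← nsmul_eq_mul]
  refine Finset.sum_le_card_nsmul _ _ _ fun a ha => ?_
  obtain ⟨haL, hax, haB⟩ := hF a ha
  have h1 : (∑ b ∈ Lᶜ, if G.Adj a b then x a * x b else 0) =
      x a * ∑ b ∈ Lᶜ.filter (G.Adj a), x b := by
    rw [← Finset.sum_filter, Finset.mul_sum]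
  have h2 : (Lᶜ.filter (G.Adj a)).card ≤ m := by
    refine (Finset.card_le_card fun b hb => ?_).trans (hm a haL)
    simp only [Finset.mem_filter, Finset.mem_compl, Finset.mem_univ, true_and] at hb ⊢
    refine ⟨fun l hl => ?_, hb.2⟩
    by_contra h
    exact haB b (hB b hb.1 ⟨l, hl, h⟩) hb.2
  have h3 : ∑ b ∈ Lᶜ.filter (G.Adj a), x b ≤ m * μ := by
    calc _ ≤ (Lᶜ.filter (G.Adj a)).card • μ := Finset.sum_le_card_nsmul _ _ _ fun b hb =>
          hμ b (Finset.mem_compl.1 (Finset.mem_filter.1 hb).1)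
      _ = ((Lᶜ.filter (G.Adj a)).card : ℝ) * μ := nsmul_eq_mul _ _
      _ ≤ m * μ := by gcongr
  rw [h1]
  exact mul_le_mul hax h3 (Finset.sum_nonneg fun b _ => hx b) hε

open Classical in
/-- The Perron vector is small in the mean on the vertices `B` that miss a neighbour in `L`. -/
theorem sum_sq_missing_le {G : SimpleGraph W} {x : W → ℝ} {ρ : ℝ} (hx : ∀ a, 0 ≤ x a)
    (heig : ∀ a, adjApply G x a = ρ * x a) (hρ : 0 ≤ ρ) {m : ℕ} {μ p s c : ℝ} {L B : Finset W}
    (hB : ∀ b, b ∈ B ↔ b ∉ L ∧ ∃ a ∈ L, ¬ G.Adj a b) (hμ0 : 0 ≤ μ)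
    (hμ : ∀ a ∉ L, x a ≤ μ) (hp : ∀ a ∈ L, p ≤ x a)
    (hm : ∀ a ∉ L, (Finset.univ.filter fun r => (∀ l ∈ L, G.Adj l r) ∧ G.Adj a r).card ≤ m)
    (hs1 : s < 1) (hs0 : 0 ≤ s) (hdeg : (degSum G B : ℝ) ≤ (s * ρ) ^ 2)
    (hsc : ∑ a ∈ L, x a - p + m * μ ≤ (1 - s) * c) :
    ρ ^ 2 * ∑ a ∈ B, x a ^ 2 ≤ c ^ 2 * B.card := by
  set σ := ∑ a ∈ L, x a with hσ
  set X := ∑ a ∈ B, x a ^ 2 with hX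
  have hX0 : 0 ≤ X := Finset.sum_nonneg fun _ _ => sq_nonneg _
  set S := ∑ a ∈ B, x a with hS
  have hS0 : 0 ≤ S := Finset.sum_nonneg fun a _ => hx a
  -- Eigenvalue equation at b: L without the missed vertex contributes at most σ - p. Neighbours
  -- outside L ∪ B are common neighbours of L, so at most m of them, each of weight at most μ.
  have hpt : ∀ b ∈ B, ρ * x b ≤ (σ - p + m * μ) + ∑ a ∈ B, if G.Adj b a then x a else 0 := by
    intro b hb
    obtain ⟨hbL, l, hl, hlb⟩ := (hB b).1 hb
    rw [← heig b, adjApply]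
    have hpt2 : ∀ a, (if G.Adj b a then x a else 0) ≤
        (if a ∈ L.erase l then x a else 0) + (if a ∈ B then (if G.Adj b a then x a else 0) else 0) +
        (if a ∈ Finset.univ.filter (fun r => (∀ l ∈ L, G.Adj l r) ∧ G.Adj b r) then μ else 0) := by
      intro a
      have h0 : 0 ≤ (if a ∈ L.erase l then x a else 0) := by split_ifs; exacts [hx a, le_rfl]
      have h1 : 0 ≤ (if a ∈ B then (if G.Adj b a then x a else 0) else 0) := by
        split_ifs; exacts [hx a, le_rfl, le_rfl]
      have h2 : 0 ≤ (if a ∈ Finset.univ.filter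
          (fun r => (∀ l ∈ L, G.Adj l r) ∧ G.Adj b r) then μ else 0) := by
        split_ifs; exacts [hμ0, le_rfl]
      by_cases hba : G.Adj b a
      · by_cases haL : a ∈ L
        · have : a ∈ L.erase l := Finset.mem_erase.2 ⟨fun h => hlb (h ▸ hba.symm), haL⟩
          rw [if_pos this, if_pos hba] at *
          linarith
        · by_cases haB : a ∈ B
          · rw [if_pos haB, if_pos hba] at *
            linarith
          · have : a ∈ Finset.univ.filter (fun r => (∀ l ∈ L, G.Adj l r) ∧ G.Adj b r) := by
              simp only [Finset.mem_filter, Finset.mem_univ, true_and]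
              refine ⟨fun l hl => ?_, hba⟩
              by_contra h
              exact haB ((hB a).2 ⟨haL, l, hl, h⟩)
            rw [if_pos this] at *
            rw [if_pos hba] at *
            have := hμ a haL
            linarith
      · rw [if_neg hba] at *
        linarith
    refine (Finset.sum_le_sum fun a _ => hpt2 a).trans ?_
    rw [Finset.sum_add_distrib, Finset.sum_add_distrib]
    simp only [Finset.sum_ite_mem, Finset.univ_inter, Finset.sum_const, nsmul_eq_mul]
    have h3 : ∑ a ∈ L.erase l, x a ≤ σ - p := by
      have := Finset.add_sum_erase L x hl
      have := hp l hl
      linarith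
    have h4 : ((Finset.univ.filter (fun r => (∀ l ∈ L, G.Adj l r) ∧ G.Adj b r)).card : ℝ) * μ ≤
        m * μ := by
      have := hm b hbL
      gcongr
    linarith
  have hsum : ρ * X ≤ (σ - p + m * μ) * S +
      ∑ b ∈ B, ∑ a ∈ B, if G.Adj b a then x b * x a else 0 := by
    rw [hX, hS, Finset.mul_sum, Finset.mul_sum, ← Finset.sum_add_distrib]
    refine Finset.sum_le_sum fun b hb => ?_
    have h3 := mul_le_mul_of_nonneg_left (hpt b hb) (hx b)
    have h4 : (∑ a ∈ B, if G.Adj b a then x b * x a else 0) =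
        x b * ∑ a ∈ B, if G.Adj b a then x a else 0 := by
      rw [Finset.mul_sum]
      exact Finset.sum_congr rfl fun a _ => by split_ifs <;> simp
    rw [h4]
    linarith
  have hBB : (∑ b ∈ B, ∑ a ∈ B, if G.Adj b a then x b * x a else 0) ≤ s * ρ * X := by
    refine le_of_sq_le_sq ?_ (by positivity)
    refine (sq_sum_edges_le G x B).trans ?_
    rw [mul_pow]
    gcongr
  -- The edges inside B take only the fraction s of ρX, so the rest is bounded by the weight seen in
  -- L; Cauchy-Schwarz for S then gives the claim.
  have h5 : ρ * X ≤ c * S := by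
    have h6 : (1 - s) * (ρ * X) ≤ (1 - s) * (c * S) := by
      have := mul_le_mul_of_nonneg_right hsc hS0
      linarith
    exact le_of_mul_le_mul_left h6 (by linarith)
  have h6 : S ^ 2 ≤ B.card * X := sq_sum_le_card_mul_sum_sq
  rcases hX0.eq_or_lt with h | h
  · rw [← h]; simpa using by positivity
  · have h7 := pow_le_pow_left₀ (by positivity) h5 2
    have h8 : c ^ 2 * S ^ 2 ≤ c ^ 2 * (B.card * X) := by gcongr
    have h9 : (ρ ^ 2 * X) * X ≤ (c ^ 2 * B.card) * X := by
      rw [mul_pow, mul_pow] at h7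
      linarith
    exact le_of_mul_le_mul_right h9 h

end

set_option maxHeartbeats 1000000 in
open Classical in
/-- In a sparse graph whose Rayleigh quotients are not increased by joining a set `L` to everything,
at the cost of the edges of `G - L` at the vertices that miss a neighbour in `L` and at `k` common
neighbours of `L`, some set of `γ` vertices is adjacent to all vertices. -/
theorem exists_isDominatingIn (γ m C k : ℕ) (hγ : 1 ≤ γ) :
    ∃ n₀ : ℕ, ∀ {W : Type w} [Fintype W] (G : SimpleGraph W) (x : W → ℝ) (ρ : ℝ),
      n₀ ≤ Fintype.card W → (∀ Z : Finset W, degSum G Z ≤ C * Z.card) →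
      (∀ A M : Finset W, A.card = γ + 1 → (∀ a ∈ A, ∀ r ∈ M, G.Adj a r) → M.card ≤ m) →
      (∀ a, 0 ≤ x a) → ∑ a, x a ^ 2 = 1 → 0 ≤ ρ → (∀ a, adjApply G x a = ρ * x a) →
      (γ * (Fintype.card W - γ) : ℝ) ≤ ρ ^ 2 →
      (∀ (L F : Finset W) (Q : Set W), L.card = γ → k ≤ F.card → (∀ l ∈ L, ∀ a ∈ F, G.Adj l a) →
        (∀ l ∈ L, ∀ a ∈ Q, G.Adj l a) → (∀ a ∈ F, a ∉ Q) →
        ∀ y : W → ℝ, adjForm (coneOn L (restrictTo G Q)) y ≤ ρ * ∑ a, y a ^ 2) →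
      ∃ L : Finset W, L.card = γ ∧ IsDominatingIn G L := by
  have hγ1 : (1 : ℝ) ≤ γ := by exact_mod_cast hγ
  have hγ0 : (0 : ℝ) < γ := by linarith
  set p : ℝ := 1 / (4 * γ) with hp
  -- Small enough for three purposes: the density of B, the contribution of common neighbours, and
  -- the loss at the k spare vertices.
  set μ : ℝ := p ^ 4 / (8 * (C + 1) * (m + 1) * (k + 1)) with hμdef
  have hp0 : 0 < p := by positivity
  have hp1 : p ≤ 1 / 4 := by
    rw [hp]; exact one_div_le_one_div_of_le (by norm_num) (by linarith)
  have hμ0 : 0 < μ := by positivity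
  have hμe : μ * ((C + 1) * (m + 1) * (k + 1)) = p ^ 4 / 8 := by
    rw [hμdef]; field_simp
  have hC1 : (0 : ℝ) ≤ C := Nat.cast_nonneg _
  have hm1 : (0 : ℝ) ≤ m := Nat.cast_nonneg _
  have hk1 : (0 : ℝ) ≤ k := Nat.cast_nonneg _
  have hμCm : (C + 1) * (k * (m * μ)) ≤ p ^ 4 / 8 := by
    rw [← hμe]
    have h1 : (k : ℝ) * m ≤ (m + 1) * (k + 1) := by nlinarith
    calc (C + 1) * (k * (m * μ)) = (C + 1) * μ * (k * m) := by ring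
      _ ≤ (C + 1) * μ * ((m + 1) * (k + 1)) := by gcongr
      _ = _ := by ring
  have hμm : (m + 1) * μ ≤ p ^ 4 / 8 := by
    rw [← hμe]
    have h1 : (1 : ℝ) ≤ (C + 1) * (k + 1) := by nlinarith [mul_nonneg hC1 hk1]
    calc (m + 1) * μ = (m + 1) * μ * 1 := by ring
      _ ≤ (m + 1) * μ * ((C + 1) * (k + 1)) := by gcongr
      _ = _ := by ring
  have hμC : C * μ ≤ p ^ 4 / 8 := by
    rw [← hμe]
    have h1 : (1 : ℝ) ≤ (m + 1) * (k + 1) := by nlinarith [mul_nonneg hm1 hk1]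
    calc C * μ ≤ (C + 1) * μ * 1 := by nlinarith
      _ ≤ (C + 1) * μ * ((m + 1) * (k + 1)) := by gcongr
      _ = _ := by ring
  have hp2 : p ^ 2 ≤ 1 / 16 := by nlinarith
  have hp4 : p ^ 4 ≤ p ^ 2 / 16 := by nlinarith [sq_nonneg p]
  have hp4' : p ^ 4 ≤ p / 64 := by nlinarith
  obtain ⟨n₁, hn₁⟩ := exists_dominating_candidates.{w} γ m C hγ hμ0
  refine ⟨max n₁ (max (2 * γ) (2 * k + 2)), fun {W} _ G x ρ hn hC hK hx h1 hρ0 heig hργ hmax => ?_⟩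
  have hn2 : 2 * γ ≤ Fintype.card W := (le_max_left _ _).trans ((le_max_right _ _).trans hn)
  have hn3 : 2 * k + 2 ≤ Fintype.card W := (le_max_right _ _).trans ((le_max_right _ _).trans hn)
  have hform : adjForm G x = ρ := by
    simp only [adjForm, heig]
    refine Eq.trans ?_ (mul_one ρ)
    rw [← h1, Finset.mul_sum]
    exact Finset.sum_congr rfl fun a _ => by ring
  obtain ⟨L, hLc, hLx, hLμ, hLW⟩ := hn₁ G x ρ ((le_max_left _ _).trans hn) hC hK hx h1 hρ0
    hform.ge hργ
  set n : ℝ := ((Fintype.card W : ℕ) : ℝ) with hndef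
  have hn2' : 2 * (γ : ℝ) ≤ n := by rw [hndef]; exact_mod_cast hn2
  have hn3' : 2 * (k : ℝ) + 2 ≤ n := by rw [hndef]; exact_mod_cast hn3
  have hn0 : 0 < n := by linarith
  have hρn : n / 2 ≤ ρ ^ 2 := by
    refine le_trans ?_ hργ
    nlinarith
  have hρ1 : 1 ≤ ρ := by nlinarith
  -- A crude bound, needed only to cancel the factor 1/√n of the entries on F.
  have hρC : ρ ≤ (C + 1) * √n := by
    refine le_of_sq_le_sq ?_ (by positivity)
    have h2 := sq_sum_edges_le G x Finset.univ
    have h3 : (∑ a, ∑ b, if G.Adj a b then x a * x b else 0) = ρ := by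
      rw [← hform]
      simp only [adjForm, adjApply, Finset.mul_sum, mul_ite, mul_zero]
    rw [h3, h1, one_pow, mul_one] at h2
    have h4 : (degSum G Finset.univ : ℝ) ≤ C * n := by
      have := hC Finset.univ
      rw [Finset.card_univ] at this
      rw [hndef]
      exact_mod_cast this
    rw [mul_pow, Real.sq_sqrt hn0.le]
    have h5 : (C : ℝ) * n ≤ (C + 1) ^ 2 * n := by
      gcongr
      nlinarith
    linarith
  set B : Finset W := Finset.univ.filter fun b => b ∉ L ∧ ∃ a ∈ L, ¬ G.Adj a b with hBdef
  have hB : ∀ b, b ∈ B ↔ b ∉ L ∧ ∃ a ∈ L, ¬ G.Adj a b := fun b => by simp [hBdef]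
  have hm : ∀ a ∉ L, (Finset.univ.filter fun r => (∀ l ∈ L, G.Adj l r) ∧ G.Adj a r).card ≤ m :=
    fun a ha => card_common_neighbors_le hK hLc ha
  obtain ⟨F, hFc, hF⟩ := exists_spare_vertices (k := k) h1 (by linarith) (fun b hb => (hB b).1 hb)
    hm hLW (by omega) (by omega)
  have hLne : L.Nonempty := Finset.card_pos.1 (by omega)
  have hFL : ∀ a ∈ F, a ∉ L := fun a ha haL => ((hF a ha).1 a haL).ne rfl
  have hLB : Disjoint L B := Finset.disjoint_left.2 fun a ha haB => ((hB a).1 haB).1 ha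
  have hLF : Disjoint L F := Finset.disjoint_left.2 fun a ha haF => hFL a haF ha
  set σ := ∑ a ∈ L, x a with hσ
  have hσγ : σ ≤ γ := by
    rw [← hLc]
    simpa using Finset.sum_le_card_nsmul L x 1 fun a _ => le_one_of_sum_sq_eq_one h1 a
  have hσp : p ≤ σ := by
    obtain ⟨l, hl⟩ := hLne
    exact (hLx l hl).trans (Finset.single_le_sum (fun a _ => hx a) hl)
  set X := ∑ a ∈ B, x a ^ 2 with hX
  have hpγ : p * γ = 1 / 4 := by rw [hp]; field_simp
  have hBX : ρ ^ 2 * X ≤ (σ - p / 2) ^ 2 * B.card := by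
    refine sum_sq_missing_le (s := p ^ 2) hx heig hρ0 hB hμ0.le hLμ hLx hm (by linarith)
      (by positivity) ?_ ?_
    · have h2 : (degSum G B : ℝ) ≤ C * B.card := by exact_mod_cast hC B
      have h3 : (B.card : ℝ) ≤ μ * n := by
        refine le_trans ?_ hLW
        exact_mod_cast Finset.card_le_card fun b hb => by
          simpa using ((hB b).1 hb).2
      calc (degSum G B : ℝ) ≤ C * (μ * n) := h2.trans (by gcongr)
        _ = (C * μ) * n := by ring
        _ ≤ (p ^ 4 / 8) * n := by gcongr
        _ = p ^ 4 * (n / 8) := by ring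
        _ ≤ p ^ 4 * ρ ^ 2 := by gcongr; linarith
        _ = (p ^ 2 * ρ) ^ 2 := by ring
    · have h2 : p ^ 2 * σ ≤ p / 4 := by
        calc p ^ 2 * σ ≤ p ^ 2 * γ := by gcongr
          _ = p / 4 := by rw [sq, mul_assoc, hpγ]; ring
      have h3 : 0 ≤ p ^ 2 * (p / 2) := by positivity
      linarith
  have hloss := sum_edges_spare_le (B := B) (F := F) (ε := 2 / √n) hx
    (fun b h2 h3 => (hB b).2 ⟨h2, h3⟩) hμ0.le hLμ (by positivity) hm
    (fun a ha => ⟨hFL a ha, (hF a ha).2⟩)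
  rw [hFc] at hloss
  set loss := ∑ a ∈ F, ∑ b ∈ Lᶜ, if G.Adj a b then x a * x b else 0 with hlossdef
  have hloss0 : 0 ≤ loss := Finset.sum_nonneg fun a _ => Finset.sum_nonneg fun b _ => by
    split_ifs
    exacts [mul_nonneg (hx a) (hx b), le_rfl]
  have hρloss : ρ * loss ≤ p ^ 2 / 16 := by
    calc ρ * loss ≤ ((C + 1) * √n) * (k * (2 / √n * (m * μ))) :=
          mul_le_mul hρC hloss hloss0 (by positivity)
      _ = 2 * ((C + 1) * (k * (m * μ))) := by field_simp
      _ ≤ p ^ 2 / 16 := by linarith [sq_nonneg p]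
  -- This maximizes 2τσ - ρτ², the net contribution of a vertex of B once its neighbourhood is
  -- exactly L.
  set τ := σ / ρ with hτ
  have hτ0 : 0 ≤ τ := div_nonneg (by linarith) hρ0
  have hlow := le_adjForm_coneOn_restrictTo (τ := τ) hx heig hτ0 hLB hLF
  rw [← hσ, ← hX, ← hlossdef, hform] at hlow
  set gain := ∑ a ∈ L, ∑ b ∈ L, if a ≠ b ∧ ¬ G.Adj a b then x a * x b else 0 with hgain
  have hup := hmax L F {a | a ∉ L ∧ a ∉ B ∧ a ∉ F} hLc hFc.ge (fun l hl a ha => (hF a ha).1 l hl)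
    (fun l hl a ha => by
      by_contra h
      exact ha.2.1 ((hB a).2 ⟨ha.1, l, hl, h⟩)) (fun a ha h => h.2.2 ha)
    (fun a => if a ∈ B then τ else x a)
  have hysq : ∑ a, (if a ∈ B then τ else x a) ^ 2 = 1 - X + B.card * τ ^ 2 := by
    rw [← h1, ← Finset.sum_add_sum_compl B, ← Finset.sum_add_sum_compl B fun a => x a ^ 2]
    rw [Finset.sum_congr rfl fun a ha => by rw [if_pos ha],
      Finset.sum_congr (rfl : Bᶜ = Bᶜ) fun a ha => by rw [if_neg (Finset.mem_compl.1 ha)]]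
    simp only [Finset.sum_const, nsmul_eq_mul, ← hX]
    ring
  rw [hysq] at hup
  -- After multiplication by ρ, the vertices of B gain σ² each and lose at most (σ - p/2)² on
  -- average; the difference is at least 3p²/4 since σ ≥ p. One vertex in B, or one missing edge in
  -- L (worth at least p²), would already exceed p²/8.
  have htot : ρ * gain + B.card * (3 / 4 * p ^ 2) ≤ p ^ 2 / 8 := by
    have h2 : ρ * τ = σ := by rw [hτ]; field_simp
    have h3 : B.card * (3 / 4 * p ^ 2) ≤ B.card * (σ ^ 2 - (σ - p / 2) ^ 2) := by
      gcongr
      nlinarith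
    have h4 := hlow.trans hup
    have h5 : ρ * (ρ - 2 * ρ * X + 2 * B.card * (τ * σ) - 2 * loss + gain) ≤
        ρ * (ρ * (1 - X + B.card * τ ^ 2)) := by gcongr
    have h6 : ρ * (2 * B.card * (τ * σ)) = 2 * B.card * σ ^ 2 := by rw [← h2]; ring
    have h7 : ρ * (ρ * (B.card * τ ^ 2)) = B.card * σ ^ 2 := by rw [← h2]; ring
    linarith
  have hgain0 : 0 ≤ gain := Finset.sum_nonneg fun a _ => Finset.sum_nonneg fun b _ => by
    split_ifs
    exacts [mul_nonneg (hx a) (hx b), le_rfl]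
  have hpp : 0 < p ^ 2 := by positivity
  refine ⟨L, hLc, fun a ha b hba => ?_⟩
  by_contra hab
  by_cases hbL : b ∈ L
  · have h2 : p ^ 2 ≤ gain := by
      have h3 : x a * x b ≤ ∑ b ∈ L, if a ≠ b ∧ ¬ G.Adj a b then x a * x b else 0 := by
        refine le_trans (le_of_eq ?_) (Finset.single_le_sum (f := fun b =>
          if a ≠ b ∧ ¬ G.Adj a b then x a * x b else 0) (fun c _ => ?_) hbL)
        · simp [hba.symm, hab]
        · split_ifs
          exacts [mul_nonneg (hx a) (hx c), le_rfl]
      have h4 := Finset.single_le_sum (f := fun a => ∑ b ∈ L,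
          if a ≠ b ∧ ¬ G.Adj a b then x a * x b else 0) (fun c _ => Finset.sum_nonneg fun d _ => by
            split_ifs
            exacts [mul_nonneg (hx c) (hx d), le_rfl]) ha
      have h5 : p * p ≤ x a * x b := mul_le_mul (hLx a ha) (hLx b hbL) hp0.le (hx a)
      rw [sq]
      exact h5.trans (h3.trans h4)
    have h3 : gain ≤ ρ * gain := le_mul_of_one_le_left hgain0 hρ1
    have h4 : 0 ≤ (B.card : ℝ) * (3 / 4 * p ^ 2) := by positivity
    linarith
  · have h2 : 1 ≤ (B.card : ℝ) := by
      exact_mod_cast Finset.card_pos.2 ⟨b, (hB b).2 ⟨hbL, a, ha, hab⟩⟩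
    have h3 : 0 ≤ ρ * gain := mul_nonneg hρ0 hgain0
    have h4 : 1 * (3 / 4 * p ^ 2) ≤ B.card * (3 / 4 * p ^ 2) := by gcongr
    linarith

/-! ### Lower bound for ρ and positivity of the Perron vector -/

section

variable {W : Type w} [Fintype W]

/-- Adding an edge between vertices of positive weight increases the quadratic form. -/
theorem adjForm_add_le_of_le {G G' : SimpleGraph W} {x : W → ℝ} (hx : ∀ a, 0 ≤ x a) (h : G ≤ G')
    {a b : W} (hab : ¬ G.Adj a b) (hab' : G'.Adj a b) :
    adjForm G x + x a * x b ≤ adjForm G' x := by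
  classical
  have h1 : ∀ c, adjApply G x c + (if c = a then x b else 0) ≤ adjApply G' x c := by
    intro c
    have h2 : (if c = a then x b else 0) = ∑ d, if c = a ∧ d = b then x d else 0 := by
      by_cases hc : c = a <;> simp [hc]
    rw [h2, adjApply, adjApply, ← Finset.sum_add_distrib]
    refine Finset.sum_le_sum fun d _ => ?_
    by_cases hcd : c = a ∧ d = b
    · obtain ⟨rfl, rfl⟩ := hcd
      simp [hab, hab']
    · by_cases hg : G.Adj c d
      · simp [hg, h hg, hcd]
      · simp only [hg, hcd, if_false, add_zero]
        split_ifs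
        exacts [hx d, le_rfl]
  have h3 : adjForm G x + x a * x b = ∑ c, x c * (adjApply G x c + if c = a then x b else 0) := by
    simp [adjForm, mul_add, Finset.sum_add_distrib]
  rw [h3]
  exact Finset.sum_le_sum fun c _ => mul_le_mul_of_nonneg_left (h1 c) (hx c)

/-- The Rayleigh quotients of the join of a set `L` with an edgeless graph. -/
theorem mul_card_sub_le_sq {L : Finset W} {ρ : ℝ} (hL : 0 < L.card) (hLn : L.card < Fintype.card W)
    (h : ∀ y : W → ℝ, adjForm (coneOn L ⊥) y ≤ ρ * ∑ a, y a ^ 2) :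
    (L.card * (Fintype.card W - L.card) : ℝ) ≤ ρ ^ 2 := by
  classical
  set g : ℝ := (L.card : ℝ) with hg
  set r : ℝ := Fintype.card W - L.card with hr
  have hg0 : 0 < g := Nat.cast_pos.2 hL
  have hr0 : 0 < r := sub_pos.2 (Nat.cast_lt.2 hLn)
  have hLc : (Lᶜ.card : ℝ) = r := by
    rw [Finset.card_compl, Nat.cast_sub hLn.le]
  -- The Perron vector of the complete bipartite graph between L and its complement; edges inside L
  -- are discarded.
  set y : W → ℝ := fun a => if a ∈ L then √r else √g with hy
  have hy0 : ∀ a, 0 ≤ y a := fun a => by simp only [hy]; split_ifs <;> positivity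
  have hsum : ∀ f : W → ℝ, ∑ a, f a = ∑ a ∈ L, f a + ∑ a ∈ Lᶜ, f a := fun f =>
    (Finset.sum_add_sum_compl L f).symm
  have hyL : ∀ a ∈ L, y a = √r := fun a ha => by simp [hy, ha]
  have hyL' : ∀ a ∈ Lᶜ, y a = √g := fun a ha => by simp [hy, Finset.mem_compl.1 ha]
  have hysq : ∑ a, y a ^ 2 = 2 * (g * r) := by
    rw [hsum, Finset.sum_congr rfl fun a ha => by rw [hyL a ha],
      Finset.sum_congr (rfl : Lᶜ = Lᶜ) fun a ha => by rw [hyL' a ha]]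
    simp only [Finset.sum_const, nsmul_eq_mul, hLc, Real.sq_sqrt hg0.le, Real.sq_sqrt hr0.le, ← hg]
    ring
  have hform : 2 * (g * r) * (√g * √r) ≤ adjForm (coneOn L ⊥) y := by
    have h1 : ∀ a ∈ L, r * √g ≤ adjApply (coneOn L ⊥) y a := by
      intro a ha
      rw [adjApply, ← hLc, ← nsmul_eq_mul]
      refine le_trans ?_ (Finset.sum_le_sum_of_subset_of_nonneg (Finset.subset_univ Lᶜ)
        fun b _ _ => by split_ifs; exacts [hy0 b, le_rfl])
      refine Finset.card_nsmul_le_sum _ _ _ fun b hb => ?_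
      have hab : (coneOn L (⊥ : SimpleGraph W)).Adj a b :=
        ⟨fun h => (Finset.mem_compl.1 hb) (h ▸ ha), Or.inl ha⟩
      rw [if_pos hab, hyL' b hb]
    have h2 : ∀ a ∈ Lᶜ, g * √r ≤ adjApply (coneOn L ⊥) y a := by
      intro a ha
      rw [adjApply, hg, ← nsmul_eq_mul]
      refine le_trans ?_ (Finset.sum_le_sum_of_subset_of_nonneg (Finset.subset_univ L)
        fun b _ _ => by split_ifs; exacts [hy0 b, le_rfl])
      refine Finset.card_nsmul_le_sum _ _ _ fun b hb => ?_
      have hab : (coneOn L (⊥ : SimpleGraph W)).Adj a b :=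
        ⟨fun h => (Finset.mem_compl.1 ha) (h ▸ hb), Or.inr (Or.inl hb)⟩
      rw [if_pos hab, hyL b hb]
    have h3 : g * (√r * (r * √g)) ≤ ∑ a ∈ L, y a * adjApply (coneOn L ⊥) y a := by
      rw [hg, ← nsmul_eq_mul]
      refine Finset.card_nsmul_le_sum _ _ _ fun a ha => ?_
      rw [hyL a ha]
      exact mul_le_mul_of_nonneg_left (h1 a ha) (Real.sqrt_nonneg _)
    have h4 : r * (√g * (g * √r)) ≤ ∑ a ∈ Lᶜ, y a * adjApply (coneOn L ⊥) y a := by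
      have h5 := Finset.card_nsmul_le_sum Lᶜ (fun a => y a * adjApply (coneOn L ⊥) y a)
        (√g * (g * √r)) fun a ha => by
          rw [hyL' a ha]
          exact mul_le_mul_of_nonneg_left (h2 a ha) (Real.sqrt_nonneg _)
      rwa [nsmul_eq_mul, hLc] at h5
    rw [adjForm, hsum]
    linarith
  have h5 : √g * √r ≤ ρ := by
    have h6 := hform.trans (h y)
    rw [hysq, mul_comm ρ] at h6
    exact le_of_mul_le_mul_left h6 (by positivity)
  have h7 := pow_le_pow_left₀ (by positivity) h5 2
  rwa [mul_pow, Real.sq_sqrt hg0.le, Real.sq_sqrt hr0.le] at h7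

/-- A nonnegative eigenvector is positive if some vertex is adjacent to all others. -/
theorem pos_of_isDominatingIn {G : SimpleGraph W} {L : Finset W} (hL : IsDominatingIn G L)
    (hLne : L.Nonempty) {x : W → ℝ} {ρ : ℝ} (hx : ∀ a, 0 ≤ x a) (h1 : ∑ a, x a ^ 2 = 1)
    (heig : ∀ a, adjApply G x a = ρ * x a) (a : W) : 0 < x a := by
  classical
  -- A zero entry forces all neighbouring entries to vanish, and a dominating vertex carries this to
  -- the whole graph.
  have key : ∀ a b, x a = 0 → G.Adj a b → x b = 0 := by
    intro a b ha hab
    have h2 : adjApply G x a = 0 := by rw [heig, ha, mul_zero]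
    have h3 := (Finset.sum_eq_zero_iff_of_nonneg (fun b _ => by
      split_ifs
      exacts [hx b, le_rfl])).1 h2 b (Finset.mem_univ b)
    simpa [hab] using h3
  by_contra h
  have ha : x a = 0 := le_antisymm (not_lt.1 h) (hx a)
  obtain ⟨l, hl⟩ := hLne
  have hxl : x l = 0 := by
    by_cases hla : a = l
    · exact hla ▸ ha
    · exact key a l ha (hL l hl a hla).symm
  have hall : ∀ b, x b = 0 := by
    intro b
    by_cases hb : b = l
    · exact hb ▸ hxl
    · exact key l b hxl (hL l hl b hb)
  simp [hall] at h1

end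

/-! ### The parameter γ and the family Γ -/

section

variable {ι : Type u} {V : ι → Type v} [∀ i, Fintype (V i)] {H : ∀ i, SimpleGraph (V i)}

/-- From γ ≥ 1 it follows that no subtraction in `gamma` is truncated; in particular every member
has an edge. -/
theorem familyGamma_add_indepNum_lt (hγ : 1 ≤ familyGamma H) (i : ι) :
    familyGamma H + (H i).indepNum < Fintype.card (V i) := by
  have h : familyGamma H ≤ gamma (H i) := ciInf_le (OrderBot.bddBelow _) i
  unfold gamma at h
  omega

theorem exists_card_eq_familyGamma [Nonempty ι] (hγ : 1 ≤ familyGamma H) :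
    ∃ i, familyGamma H + 1 + (H i).indepNum = Fintype.card (V i) := by
  obtain ⟨i, hi⟩ := ciInf_mem fun i => gamma (H i)
  refine ⟨i, ?_⟩
  have h : gamma (H i) = familyGamma H := hi
  unfold gamma at h
  omega

/-- If `L` consists of `γ` vertices adjacent to all others, then `G` is `H`-subdivision-free if and
only if `G - L` is `Γ(H)`-subdivision-free. -/
theorem isSubdivisionFree_iff_gammaFamily (hγ : 1 ≤ familyGamma H) {W : Type w} {G : SimpleGraph W}
    {L : Finset W} (hLc : L.card = familyGamma H) (hL : IsDominatingIn G L) :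
    IsSubdivisionFree H G ↔ IsSubdivisionFree (GammaFamily H) (deleteVertices G L) := by
  constructor
  · rintro h ⟨i, S, hS, hirr⟩ hc
    have := familyGamma_add_indepNum_lt hγ i
    exact h i (hL.containsSubdivision (S := S) (by omega) hc)
  · intro h i hc
    have := familyGamma_add_indepNum_lt hγ i
    obtain ⟨S, hS, hc⟩ := exists_induce_containsSubdivision hc L
      (k := Fintype.card (V i) - familyGamma H) (by omega)
    obtain ⟨T, hT, hirr, hc⟩ := exists_irreducible_containsSubdivision hc
    exact h ⟨i, T, hT.trans hS, hirr⟩ hc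

end

end SpectralSubdivision

/-! ### Extremal graphs are dominated and saturated -/

theorem theorem5p1 {ι : Type*} [Finite ι] [Nonempty ι] {V : ι → Type*} [∀ i, Fintype (V i)]
    (H : ∀ i, SimpleGraph (V i)) (hγ : 1 ≤ SpectralSubdivision.familyGamma H) :
    ∃ N : ℕ, ∀ n : ℕ, N ≤ n → ∀ G ∈ SpectralSubdivision.SPEX n H,
      ∃ L : Finset (Fin n),
        L.card = SpectralSubdivision.familyGamma H ∧
        SpectralSubdivision.IsSubdivisionSaturated (SpectralSubdivision.GammaFamily H)
          (SpectralSubdivision.deleteVertices G L) ∧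
        SpectralSubdivision.IsDominatingIn G L ∧
        (∀ G' : SimpleGraph (Fin n), SpectralSubdivision.IsDominatingIn G' L →
          (SpectralSubdivision.IsSubdivisionFree H G' ↔
            SpectralSubdivision.IsSubdivisionFree (SpectralSubdivision.GammaFamily H)
              (SpectralSubdivision.deleteVertices G' L))) := by
  open SpectralSubdivision in
  classical
  set γ := familyGamma H with hγdef
  obtain ⟨i₀, hi₀⟩ := exists_card_eq_familyGamma hγ
  obtain ⟨C, hC⟩ := exists_degSum_bound.{_, 0} (H i₀)
  -- By finiteness of the family one k suffices for all members, both as the bound on common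
  -- neighbours and as the number of spare vertices.
  obtain ⟨k, hk⟩ := (Set.finite_range fun i => Fintype.card (V i ⊕ Sym2 (V i))).bddAbove
  have hk : ∀ i, Fintype.card (V i ⊕ Sym2 (V i)) ≤ k := fun i => hk ⟨i, rfl⟩
  obtain ⟨n₀, hn₀⟩ := exists_isDominatingIn.{0} γ k C k hγ
  refine ⟨max n₀ (γ + 1), fun n hn G hG => ?_⟩
  obtain ⟨hfree, hmax⟩ := hG
  have hn1 : n₀ ≤ n := (le_max_left _ _).trans hn
  have hn2 : γ + 1 ≤ n := (le_max_right _ _).trans hn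
  have : Nonempty (Fin n) := ⟨⟨0, by omega⟩⟩
  obtain ⟨x, ρ, hρ0, hx, h1, heig, hray, hspec⟩ := exists_perron G
  have hle : ∀ G' : SimpleGraph (Fin n), IsSubdivisionFree H G' →
      ∀ y : Fin n → ℝ, adjForm G' y ≤ ρ * ∑ a, y a ^ 2 := by
    intro G' hG' y
    obtain ⟨-, ρ', -, -, -, -, hray', hspec'⟩ := exists_perron G'
    have h2 := hmax G' hG'
    rw [hspec, hspec', ENNReal.ofReal_le_ofReal_iff hρ0] at h2
    exact (hray' y).trans (by gcongr)
  have hρn : (γ * (Fintype.card (Fin n) - γ) : ℝ) ≤ ρ ^ 2 := by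
    obtain ⟨L, -, hL⟩ := Finset.exists_subset_card_eq (s := (Finset.univ : Finset (Fin n)))
      (n := γ) (by simp; omega)
    rw [← hL]
    refine mul_card_sub_le_sq (by omega) (by rw [Fintype.card_fin]; omega) (hle _ fun i => ?_)
    exact not_containsSubdivision_coneOn_bot (by
      rw [hL]; exact familyGamma_add_indepNum_lt hγ i)
  obtain ⟨L, hLc, hL⟩ := hn₀ G x ρ (by simpa using hn1)
    (fun Z => by
      by_contra h
      rcases Z.eq_empty_or_nonempty with rfl | hZ
      · simp [degSum] at h
      · exact hfree i₀ (hC G Z hZ (not_le.1 h).le).of_induce)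
    (fun A M hA hAM => by
      by_contra h
      exact hfree i₀ (containsSubdivision_of_common_neighbors (by omega) hAM
        ((hk i₀).trans (not_le.1 h).le)))
    hx h1 hρ0 heig hρn
    (fun L F Q hLc hF hLF hLQ hFQ y => hle _ (fun i hc => hfree i
      (containsSubdivision_of_coneOn_restrictTo
        (by have := familyGamma_add_indepNum_lt hγ i; omega) hLF ((hk i).trans hF) hLQ hFQ hc)) y)
  refine ⟨L, hLc, ⟨(isSubdivisionFree_iff_gammaFamily hγ hLc hL).1 hfree, fun a b hab hadj => ?_⟩,
    hL, fun G' hG' => isSubdivisionFree_iff_gammaFamily hγ hLc hG'⟩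
  -- If the new edge created no Γ(ℍ)-subdivision, G with this edge would still be dominated by L,
  -- hence ℍ-subdivision-free, and its quadratic form at x would exceed ρ by at least x a · x b > 0.
  by_contra hno
  push Not at hno
  have hdom : IsDominatingIn (G ⊔ SimpleGraph.edge a.1 b.1) L := fun c hc d hd =>
    Or.inl (hL c hc d hd)
  have hsub : deleteVertices (G ⊔ SimpleGraph.edge a.1 b.1) L ≤
      deleteVertices G L ⊔ SimpleGraph.edge a b := by
    intro c d hcd
    rcases hcd with hcd | hcd
    · exact Or.inl hcd
    · refine Or.inr ?_
      simp only [Function.Embedding.subtype_apply, SimpleGraph.edge_adj] at hcd ⊢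
      simpa [Subtype.ext_iff] using hcd
  have hfree' : IsSubdivisionFree H (G ⊔ SimpleGraph.edge a.1 b.1) :=
    (isSubdivisionFree_iff_gammaFamily hγ hLc hdom).2 fun j hj => hno j (hj.mono hsub)
  have hab1 : a.1 ≠ b.1 := fun h => hab (Subtype.ext h)
  have h2 := adjForm_add_le_of_le hx (le_sup_left : G ≤ G ⊔ SimpleGraph.edge a.1 b.1)
    (a := a.1) (b := b.1) hadj (Or.inr (by simp [SimpleGraph.edge_adj, hab1]))
  have h3 := hle _ hfree' x
  have hform : adjForm G x = ρ * ∑ a, x a ^ 2 := by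
    simp only [adjForm, heig, Finset.mul_sum]
    exact Finset.sum_congr rfl fun a _ => by ring
  have hLne : L.Nonempty := Finset.card_pos.1 (by omega)
  have h4 := mul_pos (pos_of_isDominatingIn hL hLne hx h1 heig a.1)
    (pos_of_isDominatingIn hL hLne hx h1 heig b.1)
  linarith
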